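/- **Setting.** Let $\ell\ge 1$ and $n=2^\ell$. A Cayley graph $G$ on $\mathbb F_2^\ell$ is given by a probability distribution $w$ on $\mathbb F_2^\ell$ (uniform on $S$ for the Cayley graph with generating set $S$); its random-walk operator is $(Gf)(x)=\sum_s w(s)f(x+s)$. The measure of $U\subseteq\mathbb F_2^\ell$ is $|U|/n$, and the expansion of a nonempty $U$ is $\Pr[x+s\notin U]$ for $x$ uniform in $U$ and $s\sim w$ independent. Functions $f:\mathbb F_2^\ell\to\mathbb R$ carry the norms $\|f\|_p=(\mathbb E_x|f(x)|^p)^{1/p}$ with $x$ uniform. For $\lambda\in\mathbb R$ let $V_{\ge\lambda}$ be the span of the eigenfunctions of $G$ with eigenvalue at least $\lambda$, let $\Pi_{\ge\lambda}$ be the orthogonal projector onto it, and let $P_\lambda(f)=\|\Pi_{\ge\lambda}f\|_4^4$, a homogeneous polynomial of degree $4$ in the $n$ variables $f(x)$. Let $K_\lambda(G)=\|P_\lambda\|_{\mathrm{spectral}}$ be the minimum, over all quadratic forms $Q$ on $(\mathbb R^{\mathbb F_2^\ell})^{\otimes 2}=\mathbb R^{\mathbb F_2^\ell\times\mathbb F_2^\ell}$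 with $Q(f\otimes f)=P_\lambda(f)$ for all $f$, of the spectral norm $\max_{F\neq0}|Q(F)|/\mathbb E F^2$ of $Q$. A degree-$d$ pseudo-expectation $\tilde{\mathbb E}$ is a linear functional on the real polynomials of degree at most $d$ in the variables $f(x)$ with $\tilde{\mathbb E}\,1=1$ and $\tilde{\mathbb E}\,p^2\ge 0$ whenever $\deg p\le d/2$; it is consistent with $\|f\|_2^2=1$ if $\tilde{\mathbb E}(\|f\|_2^2-1)^2=0$. Let $\mathrm{sos}_d(P_\lambda)$ be the supremum of $\tilde{\mathbb E}P_\lambda$ over all degree-$d$ pseudo-expectations consistent with $\|f\|_2^2=1$; this is the degree-$d$ sum-of-squares relaxation of $\max\{\|f\|_4^4 : f\in V_{\ge\lambda},\ \|f\|_2=1\}$. **Theorem.** There are absolute constants $C\ge1$, $A>0$, $k\in\mathbb N$, $\mu_0>0$ and $\varepsilon_0>0$ such that for all $0<\mu\le\mu_0$ and $0<\varepsilon\le\varepsilon_0$ there is a threshold $\theta=\theta(\mu,\varepsilon)>0$ with the following property. Put $\lambda=1-C\varepsilon$. For every $\ell\ge1$, every Cayley graph $G$ on $\mathbb F_2^\ell$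 and every integer $d\ge A\,K_\lambda(G)^k\log n$: * **Yes:** if $G$ contains a nonempty vertex set of measure at most $\mu$ and expansion at most $\varepsilon$, then $\mathrm{sos}_d(P_\lambda)\ge 2\theta$; * **No:** if all nonempty vertex sets of measure at most $C\sqrt\mu$ in $G$ have expansion at least $1-1/C$, then $\mathrm{sos}_d(P_\lambda)\le\theta$. Thus sum-of-squares relaxations of degree $K_\lambda(G)^{O(1)}\log n$ distinguish the two cases. -/

import Mathlib

noncomputable section

namespace CayleySSE

/-- The vertex set `𝔽₂^ℓ`; it has `n = 2 ^ ℓ` elements. -/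
abbrev Vertex (ℓ : ℕ) : Type := Fin ℓ → ZMod 2

/-- A Cayley graph on `𝔽₂^ℓ`, given by its step distribution: the random walk moves from `x` to
`x + s` with probability `weight s`. The Cayley graph of a generating set `S` is the case where
`weight` is uniform on `S`; weighted examples such as the noisy hypercube are included.
Since `-s = s` in `𝔽₂^ℓ`, these graphs are automatically undirected. -/
structure CayleyGraph (ℓ : ℕ) where
  weight : Vertex ℓ → ℝ
  weight_nonneg : ∀ s, 0 ≤ weight s
  weight_sum : ∑ s, weight s = 1

section Polynomials

variable {ι : Type*} [Fintype ι]

/-- Expectation with respect to the uniform probability measure on `ι`. -/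
def mean (f : ι → ℝ) : ℝ := (Fintype.card ι : ℝ)⁻¹ * ∑ i, f i

/-- The polynomial `‖f‖₂² = 𝔼ₓ f(x)²` in the indeterminates `f(x)`, `x ∈ ι`. -/
def normSqPoly (ι : Type*) [Fintype ι] : MvPolynomial ι ℝ :=
  MvPolynomial.C (Fintype.card ι : ℝ)⁻¹ * ∑ i, MvPolynomial.X i ^ 2

/-- The tensor square `f ⊗ f`, an element of `(ℝ^ι)^{⊗2} = ℝ^(ι × ι)`. -/
def tensorSq (f : ι → ℝ) : ι × ι → ℝ := fun p => f p.1 * f p.2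

/-- The spectral norm of a quadratic form on `(ℝ^κ, ‖F‖₂² = 𝔼 F²)`: the least `c ≥ 0` with
`|Q(F)| ≤ c ‖F‖₂²` for all `F`. -/
def quadNorm {κ : Type*} [Fintype κ] (Q : QuadraticForm ℝ (κ → ℝ)) : ℝ :=
  sInf {c : ℝ | 0 ≤ c ∧ ∀ F : κ → ℝ, |Q F| ≤ c * mean (fun i => F i ^ 2)}

/-- The spectral norm of a homogeneous polynomial of degree four: the minimum of the spectral
norms of the quadratic forms `Q` on `(ℝ^ι)^{⊗2}` with `Q(f ⊗ f) = P(f)` for all `f`. -/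
def polySpectralNorm (P : MvPolynomial ι ℝ) : ℝ :=
  sInf {c : ℝ | ∃ Q : QuadraticForm ℝ (ι × ι → ℝ),
    (∀ f : ι → ℝ, Q (tensorSq f) = MvPolynomial.eval f P) ∧ c = quadNorm Q}

/-- A degree-`d` pseudo-expectation functional. Only its values on polynomials of degree at most
`d` matter; since a linear functional on these extends linearly to all polynomials, nothing is
lost by letting it be defined everywhere. -/
structure PseudoExpectation (ι : Type*) (d : ℕ) where
  toLin : MvPolynomial ι ℝ →ₗ[ℝ] ℝ
  map_one : toLin 1 = 1
  map_sq_nonneg : ∀ p : MvPolynomial ι ℝ, 2 * p.totalDegree ≤ d → 0 ≤ toLin (p ^ 2)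

/-- Consistency with the polynomial constraint `p ≡ 0`. -/
def PseudoExpectation.Consistent {ι : Type*} {d : ℕ} (E : PseudoExpectation ι d)
    (p : MvPolynomial ι ℝ) : Prop :=
  E.toLin (p ^ 2) = 0

/-- The value of the degree-`d` sum-of-squares relaxation of `max {P(f) : ‖f‖₂ = 1}`. It is a
supremum in the extended reals, so that no convention about unbounded sets enters. -/
def sosValue (d : ℕ) (P : MvPolynomial ι ℝ) : EReal :=
  sSup {v : EReal | ∃ E : PseudoExpectation ι d,
    E.Consistent (normSqPoly ι - 1) ∧ v = ((E.toLin P : ℝ) : EReal)}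

end Polynomials

namespace CayleyGraph

variable {ℓ : ℕ} (G : CayleyGraph ℓ)

/-- The random-walk matrix of `G`, as an operator on functions on the vertices. -/
def walk : (Vertex ℓ → ℝ) →ₗ[ℝ] (Vertex ℓ → ℝ) where
  toFun f x := ∑ s, G.weight s * f (x + s)
  map_add' f g := by
    funext x
    simp [mul_add, Finset.sum_add_distrib]
  map_smul' c f := by
    funext x
    simp only [Pi.smul_apply, smul_eq_mul, RingHom.id_apply, Finset.mul_sum]
    exact Finset.sum_congr rfl fun s _ => by ring

/-- `V_{≥ lam}`, the span of the eigenfunctions with eigenvalue at least `lam`. -/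
def topSpace (lam : ℝ) : Submodule ℝ (Vertex ℓ → ℝ) :=
  ⨆ (ν : ℝ) (_ : lam ≤ ν), Module.End.eigenspace G.walk ν

/-- The orthogonal projector onto `V_{≥ lam}`. (The inner products for the counting measure and
for the uniform measure are proportional, hence have the same orthogonal projectors.) -/
def proj (lam : ℝ) (f : Vertex ℓ → ℝ) : Vertex ℓ → ℝ :=
  WithLp.ofLp
    (((G.topSpace lam).map
      (WithLp.linearEquiv 2 ℝ (Vertex ℓ → ℝ)).symm.toLinearMap).starProjection
        (WithLp.toLp 2 f))

/-- The polynomial `P_lam(f) = ‖Π_{≥ lam} f‖₄⁴ = 𝔼ₓ (Π_{≥ lam} f)(x)⁴` in the indeterminates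
`f(y)`; the `(x, y)` entry of the projector is its value at `x` on the indicator function
of `y`. -/
def topPoly (lam : ℝ) : MvPolynomial (Vertex ℓ) ℝ :=
  MvPolynomial.C (Fintype.card (Vertex ℓ) : ℝ)⁻¹ *
    ∑ x, (∑ y, MvPolynomial.C (G.proj lam (Pi.single y 1) x) * MvPolynomial.X y) ^ 4

/-- `K_lam(G)`, the spectral norm of `P_lam`. -/
def specK (lam : ℝ) : ℝ := polySpectralNorm (G.topPoly lam)

/-- The measure `|U| / n` of a vertex set. -/
def measure (U : Finset (Vertex ℓ)) : ℝ := (U.card : ℝ) / (Fintype.card (Vertex ℓ) : ℝ)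

/-- The expansion of a nonempty vertex set `U`: the probability that a random step from a
uniformly random vertex of `U` leaves `U`. -/
def expansion (U : Finset (Vertex ℓ)) : ℝ :=
  (∑ x ∈ U, ∑ s, if x + s ∈ U then 0 else G.weight s) / (U.card : ℝ)

/-- The Yes case: some nonempty vertex set has measure at most `μ` and expansion at most `ε`. -/
def YesCase (μ ε : ℝ) : Prop :=
  ∃ U : Finset (Vertex ℓ), U.Nonempty ∧ measure U ≤ μ ∧ G.expansion U ≤ ε

/-- Every nonempty vertex set of measure at most `δ` has expansion at least `η`. -/
def NoCase (δ η : ℝ) : Prop :=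
  ∀ U : Finset (Vertex ℓ), U.Nonempty → measure U ≤ δ → η ≤ G.expansion U

end CayleyGraph

end CayleySSE

end

/-!
The polynomial `P_lam` has nonnegative (indeed zero-one) coefficients in the Fourier basis: its
monomials are the products of four Fourier coefficients at frequencies in the top part of the
spectrum that sum to zero. Three facts are combined.

*Yes case* (`exists_eval_topPoly_ge`). The normalized indicator of a non-expanding set of measure
at most `μ` keeps half of its squared norm when projected to the top space, and Hölder's
inequality turns the correlation of the projection with the set into a fourth moment of order
`1 / μ`. Evaluation at this point is a pseudo-expectation.

*True maximum in the No case* (`eval_topPoly_le_of_noCase`). Let `g` be the projection of a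
maximizer. The vector `g - G g` lies in the top space and is short in the second norm, so
maximality makes it short in the fourth norm. Hence `g ^ 4` varies little along edges in the first
norm, and the local Cheeger inequality `mean_le_edgeMean_abs`, applied to `g ^ 4` truncated at a
threshold, contradicts expansion of the small level sets unless the maximum is of order at most
`1 / δ`, where `δ` is the measure up to which sets expand. With `δ` of order `√μ` this is far below
the Yes value `1 / μ`.

*Rounding* (`toLin_topPoly_le`). A quadratic form that nearly attains the spectral norm may
have negative entries in the basis of characters. Its rows have square sum at most the squared norm, and since
the coefficients of `P_lam` are zero or one, the squared entries can be rescaled downwards to a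
nonnegative matrix that represents `P_lam` and has row sums at most the squared norm
(`exists_nonneg_matrix`). A pseudo-distribution on the sphere defines an exchangeable sequence of
random frequencies, with weights `Ẽ ∏ f̂(aᵢ)²`. By telescoping entropies, conditioning on a prefix
makes two further letters nearly independent in Hellinger distance
(`exists_wordSum_hellinger_le`). Conditioned on the prefix, the Cauchy–Schwarz inequality bounds each
pseudo-moment of `P_lam` by square roots of pair weights, and these are close to the product form,
on which the nonnegative matrix takes the value of `P_lam` at an actual unit vector. With prefixes
of length `K ^ 4 log n` the error is bounded by a constant.
-/

noncomputable section

open Finset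

namespace CayleySSE

/-! ### Fourier analysis on `𝔽₂^ℓ` -/

section Mean

variable {ι : Type*} [Fintype ι]

theorem mean_add (f g : ι → ℝ) : mean (fun i => f i + g i) = mean f + mean g := by
  simp [mean, sum_add_distrib, mul_add]

theorem mean_sub (f g : ι → ℝ) : mean (fun i => f i - g i) = mean f - mean g := by
  simp [mean, sum_sub_distrib, mul_sub]

theorem mean_const_mul (c : ℝ) (f : ι → ℝ) : mean (fun i => c * f i) = c * mean f := by
  simp only [mean, ← mul_sum]; ring

theorem mean_mono {f g : ι → ℝ} (h : ∀ i, f i ≤ g i) : mean f ≤ mean g :=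
  mul_le_mul_of_nonneg_left (sum_le_sum fun i _ => h i) (by positivity)

theorem mean_nonneg {f : ι → ℝ} (h : ∀ i, 0 ≤ f i) : 0 ≤ mean f :=
  mul_nonneg (by positivity) (sum_nonneg fun i _ => h i)

theorem mean_sum {κ : Type*} (s : Finset κ) (f : κ → ι → ℝ) :
    mean (fun i => ∑ k ∈ s, f k i) = ∑ k ∈ s, mean (f k) := by
  simp only [mean]; rw [sum_comm, mul_sum]

end Mean

variable {ℓ : ℕ}

/-- The nontrivial real character of `ℤ/2`. -/
def signChar (a : ZMod 2) : ℝ := if a = 0 then 1 else -1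

theorem signChar_add (a b : ZMod 2) : signChar (a + b) = signChar a * signChar b := by
  have h : ∀ a b : ZMod 2, a + b = 0 ↔ (a = 0 ↔ b = 0) := by decide
  simp only [signChar, h]
  by_cases ha : a = 0 <;> by_cases hb : b = 0 <;> simp [ha, hb]

/-- The character `χ_a(x) = (-1)^⟨a, x⟩` of `𝔽₂^ℓ`. -/
def chi (a x : Vertex ℓ) : ℝ := signChar (∑ i, a i * x i)

theorem chi_comm (a x : Vertex ℓ) : chi a x = chi x a := by
  simp only [chi, mul_comm]

theorem chi_add_right (a x y : Vertex ℓ) : chi a (x + y) = chi a x * chi a y := by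
  simp only [chi, ← signChar_add, ← sum_add_distrib, Pi.add_apply, mul_add]

theorem chi_add_left (a b x : Vertex ℓ) : chi (a + b) x = chi a x * chi b x := by
  rw [chi_comm, chi_add_right, chi_comm x, chi_comm x]

theorem chi_zero_left (x : Vertex ℓ) : chi 0 x = 1 := by simp [chi, signChar]

theorem abs_chi (a x : Vertex ℓ) : |chi a x| = 1 := by
  unfold chi signChar; split_ifs <;> norm_num

theorem vertex_add_self (x : Vertex ℓ) : x + x = 0 := by
  funext i; exact CharTwo.add_self_eq_zero (x i)

theorem vertex_add_add_cancel (x s : Vertex ℓ) : x + s + s = x := by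
  rw [add_assoc, vertex_add_self, add_zero]

theorem vertex_add_eq_zero_iff (x y : Vertex ℓ) : x + y = 0 ↔ x = y := by
  constructor
  · intro h
    have := congrArg (· + y) h
    simpa [vertex_add_add_cancel] using this
  · rintro rfl; exact vertex_add_self x

theorem sum_comp_add {M : Type*} [AddCommMonoid M] (f : Vertex ℓ → M) (s : Vertex ℓ) :
    ∑ x, f (x + s) = ∑ x, f x :=
  Fintype.sum_equiv (Equiv.addRight s) _ _ fun _ => rfl

theorem mean_comp_add (f : Vertex ℓ → ℝ) (s : Vertex ℓ) :
    mean (fun x => f (x + s)) = mean f := by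
  simp only [mean, sum_comp_add]

theorem card_vertex_pos : (0 : ℝ) < (Fintype.card (Vertex ℓ) : ℝ) := by
  exact_mod_cast Fintype.card_pos

theorem mean_const (c : ℝ) : mean (fun _ : Vertex ℓ => c) = c := by
  have := (card_vertex_pos (ℓ := ℓ)).ne'
  simp [mean]

theorem mean_chi (a : Vertex ℓ) : mean (chi a) = if a = 0 then 1 else 0 := by
  split_ifs with h
  · subst h
    rw [show chi (0 : Vertex ℓ) = fun _ => (1 : ℝ) from funext chi_zero_left, mean_const]
  · obtain ⟨i, hi⟩ := Function.ne_iff.1 h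
    have hi1 : a i = 1 := by
      have : ∀ z : ZMod 2, z ≠ 0 → z = 1 := by decide
      exact this _ hi
    -- translation by the `i`-th basis vector flips the sign of the character
    have h1 : chi a (Pi.single i 1) = -1 := by
      simp [chi, signChar, Pi.single_apply, hi1]
    have h2 := mean_comp_add (chi a) (Pi.single i 1)
    simp only [chi_add_right, h1] at h2
    rw [show (fun x => chi a x * (-1 : ℝ)) = fun x => (-1 : ℝ) * chi a x from
      funext fun x => mul_comm _ _, mean_const_mul] at h2
    linarith

/-- The Fourier coefficient `f̂(a) = 𝔼ₓ χ_a(x) f(x)`. -/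
def fhat (f : Vertex ℓ → ℝ) (a : Vertex ℓ) : ℝ := mean fun x => chi a x * f x

theorem mean_chi_mul_chi (a b : Vertex ℓ) :
    mean (fun x => chi a x * chi b x) = if a = b then 1 else 0 := by
  simp only [← chi_add_left]
  rw [show (fun x => chi (a + b) x) = chi (a + b) from rfl, mean_chi]
  simp [vertex_add_eq_zero_iff]

theorem sum_chi_mul_chi (x y : Vertex ℓ) :
    ∑ a, chi a x * chi a y = if x = y then (Fintype.card (Vertex ℓ) : ℝ) else 0 := by
  have h := mean_chi_mul_chi x y
  have hn := (card_vertex_pos (ℓ := ℓ)).ne'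
  simp only [mean, chi_comm x, chi_comm y] at h
  rw [inv_mul_eq_iff_eq_mul₀ hn] at h
  rw [h]; split_ifs <;> simp

theorem fourier_inversion (f : Vertex ℓ → ℝ) (x : Vertex ℓ) :
    ∑ a, fhat f a * chi a x = f x := by
  have hn := (card_vertex_pos (ℓ := ℓ)).ne'
  have : ∀ a, fhat f a * chi a x =
      (Fintype.card (Vertex ℓ) : ℝ)⁻¹ * ∑ y, f y * (chi a y * chi a x) := by
    intro a
    simp only [fhat, mean, mul_assoc, sum_mul]
    congr 1
    exact sum_congr rfl fun y _ => by ring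
  simp only [this, ← mul_sum]
  rw [sum_comm]
  simp only [← mul_sum, sum_chi_mul_chi]
  simp
  field_simp

/-- Parseval's identity. -/
theorem mean_mul_eq_sum_fhat (f g : Vertex ℓ → ℝ) :
    mean (fun x => f x * g x) = ∑ a, fhat f a * fhat g a := by
  have : ∀ x, f x * g x = ∑ a, fhat f a * (chi a x * g x) := by
    intro x
    nth_rw 1 [← fourier_inversion f x]
    rw [sum_mul]
    exact sum_congr rfl fun a _ => by ring
  simp only [this]
  rw [mean_sum]
  exact sum_congr rfl fun a _ => by rw [mean_const_mul]; rfl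

theorem mean_sq_eq_sum_fhat (f : Vertex ℓ → ℝ) :
    mean (fun x => f x ^ 2) = ∑ a, fhat f a ^ 2 := by
  simp only [sq]; exact mean_mul_eq_sum_fhat f f

theorem fhat_sum_chi (c : Vertex ℓ → ℝ) (a : Vertex ℓ) :
    fhat (fun x => ∑ b, c b * chi b x) a = c a := by
  simp only [fhat, mul_sum]
  rw [mean_sum]
  have : ∀ b, mean (fun x => chi a x * (c b * chi b x)) = c b * if a = b then 1 else 0 := by
    intro b
    rw [← mean_chi_mul_chi, ← mean_const_mul]
    congr 1; funext x; ring
  simp [this]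

/-- The Fourier transform as a linear map. -/
def fhatₗ (ℓ : ℕ) : (Vertex ℓ → ℝ) →ₗ[ℝ] (Vertex ℓ → ℝ) where
  toFun := fhat
  map_add' f g := by
    funext a
    simp only [fhat, Pi.add_apply, mul_add, mean_add]
  map_smul' c f := by
    funext a
    simp only [fhat, Pi.smul_apply, smul_eq_mul, RingHom.id_apply, ← mean_const_mul]
    congr 1; funext x; ring

theorem fhat_smul (c : ℝ) (f : Vertex ℓ → ℝ) (a : Vertex ℓ) :
    fhat (c • f) a = c * fhat f a :=
  congrFun ((fhatₗ ℓ).map_smul c f) a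

theorem fhat_add (f g : Vertex ℓ → ℝ) (a : Vertex ℓ) :
    fhat (f + g) a = fhat f a + fhat g a :=
  congrFun ((fhatₗ ℓ).map_add f g) a

theorem fhat_sub (f g : Vertex ℓ → ℝ) (a : Vertex ℓ) :
    fhat (f - g) a = fhat f a - fhat g a :=
  congrFun ((fhatₗ ℓ).map_sub f g) a

theorem fhat_eq_zero_iff (f : Vertex ℓ → ℝ) : (∀ a, fhat f a = 0) ↔ f = 0 := by
  constructor
  · intro h; funext x; rw [← fourier_inversion f x]; simp [h]
  · rintro rfl a; simp [fhat, mean]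

/-! ### The spectrum of the random walk and the projector onto its top part -/

namespace CayleyGraph

variable (G : CayleyGraph ℓ)

/-- The eigenvalue of the random walk on the character `χ_a`. -/
def symbol (a : Vertex ℓ) : ℝ := ∑ s, G.weight s * chi a s

theorem symbol_le_one (a : Vertex ℓ) : G.symbol a ≤ 1 := by
  rw [← G.weight_sum]
  refine sum_le_sum fun s _ => ?_
  have := (abs_le.1 (abs_chi a s).le).2
  nlinarith [G.weight_nonneg s]

theorem symbol_zero : G.symbol 0 = 1 := by
  simp [symbol, chi_zero_left, G.weight_sum]

theorem walk_apply (f : Vertex ℓ → ℝ) (x : Vertex ℓ) :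
    G.walk f x = ∑ s, G.weight s * f (x + s) := rfl

theorem walk_chi (a : Vertex ℓ) : G.walk (chi a) = G.symbol a • chi a := by
  funext x
  simp only [walk_apply, chi_add_right, Pi.smul_apply, smul_eq_mul, symbol, sum_mul]
  exact sum_congr rfl fun s _ => by ring

theorem fhat_walk (f : Vertex ℓ → ℝ) (a : Vertex ℓ) :
    fhat (G.walk f) a = G.symbol a * fhat f a := by
  simp only [fhat, walk_apply, mul_sum]
  rw [mean_sum]
  rw [symbol, sum_mul]
  refine sum_congr rfl fun s _ => ?_
  rw [← mean_const_mul, ← mean_comp_add _ s]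
  congr 1; funext x
  rw [vertex_add_add_cancel, chi_add_right]
  ring

theorem mem_topSpace_iff (lam : ℝ) (f : Vertex ℓ → ℝ) :
    f ∈ G.topSpace lam ↔ ∀ a, G.symbol a < lam → fhat f a = 0 := by
  constructor
  · intro hf
    let W : Submodule ℝ (Vertex ℓ → ℝ) :=
      { carrier := {f | ∀ a, G.symbol a < lam → fhat f a = 0}
        add_mem' := fun {f g} hf hg a ha => by
          rw [fhat_add, hf a ha, hg a ha, add_zero]
        zero_mem' := fun a _ => (fhat_eq_zero_iff 0).2 rfl a
        smul_mem' := fun c f hf a ha => by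
          rw [fhat_smul, hf a ha, mul_zero] }
    have hW : G.topSpace lam ≤ W := by
      refine iSup₂_le fun ν hν g hg a ha => ?_
      have h1 := G.fhat_walk g a
      rw [Module.End.mem_eigenspace_iff.1 hg] at h1
      rw [fhat_smul] at h1
      have : (ν - G.symbol a) * fhat g a = 0 := by linear_combination h1
      rcases mul_eq_zero.1 this with h | h
      · linarith
      · exact h
    exact hW hf
  · intro h
    have hf : f = ∑ a, fhat f a • chi a := by
      funext x
      simp [← fourier_inversion f x, Finset.sum_apply]
    rw [hf]
    refine Submodule.sum_mem _ fun a _ => ?_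
    rcases lt_or_ge (G.symbol a) lam with ha | ha
    · simp [h a ha]
    · refine Submodule.smul_mem _ _ ?_
      exact Submodule.mem_iSup_of_mem _ (Submodule.mem_iSup_of_mem ha
        (Module.End.mem_eigenspace_iff.2 (G.walk_chi a)))

open Classical in
theorem proj_apply (lam : ℝ) (f : Vertex ℓ → ℝ) (x : Vertex ℓ) :
    G.proj lam f x = ∑ a, (if lam ≤ G.symbol a then fhat f a else 0) * chi a x := by
  set g : Vertex ℓ → ℝ := fun x => ∑ a, (if lam ≤ G.symbol a then fhat f a else 0) * chi a x
    with hg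
  have hghat : ∀ a, fhat g a = if lam ≤ G.symbol a then fhat f a else 0 := fun a => by
    rw [hg, fhat_sum_chi]
  have key : ((G.topSpace lam).map
      (WithLp.linearEquiv 2 ℝ (Vertex ℓ → ℝ)).symm.toLinearMap).starProjection
        (WithLp.toLp 2 f) = WithLp.toLp 2 g := by
    refine Submodule.eq_starProjection_of_mem_of_inner_eq_zero ?_ ?_
    · refine Submodule.mem_map.2 ⟨g, ?_, rfl⟩
      rw [mem_topSpace_iff]
      intro a ha
      rw [hghat, if_neg (not_le.2 ha)]
    · rintro w hw
      obtain ⟨v, hv, rfl⟩ := Submodule.mem_map.1 hw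
      rw [mem_topSpace_iff] at hv
      have h0 : mean (fun x => v x * (f - g) x) = 0 := by
        rw [mean_mul_eq_sum_fhat]
        refine sum_eq_zero fun a _ => ?_
        rw [fhat_sub, hghat]
        split_ifs with h
        · simp
        · rw [hv a (not_le.1 h), zero_mul]
      have hn := (card_vertex_pos (ℓ := ℓ)).ne'
      rw [mean, mul_eq_zero] at h0
      have h0 := h0.resolve_left (inv_ne_zero hn)
      simpa [PiLp.inner_apply] using h0
  simp only [proj, key, hg]

open Classical in
theorem fhat_proj (lam : ℝ) (f : Vertex ℓ → ℝ) (a : Vertex ℓ) :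
    fhat (G.proj lam f) a = if lam ≤ G.symbol a then fhat f a else 0 := by
  rw [show G.proj lam f = _ from funext (G.proj_apply lam f), fhat_sum_chi]

theorem sum_proj_single (lam : ℝ) (f : Vertex ℓ → ℝ) (x : Vertex ℓ) :
    ∑ y, G.proj lam (Pi.single y 1) x * f y = G.proj lam f x := by
  classical
  simp only [proj_apply, sum_mul]
  rw [sum_comm]
  refine sum_congr rfl fun a _ => ?_
  split_ifs with h
  · simp only [fhat, mean, mul_assoc, mul_sum, sum_mul]
    refine sum_congr rfl fun y _ => ?_
    simp only [Pi.single_apply, mul_ite, mul_zero, sum_ite_eq', mem_univ, if_true,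
      ite_mul, zero_mul]
    ring
  · simp

theorem eval_topPoly (lam : ℝ) (f : Vertex ℓ → ℝ) :
    MvPolynomial.eval f (G.topPoly lam) = mean (fun x => G.proj lam f x ^ 4) := by
  simp [topPoly, mean, sum_proj_single]

/-- The coefficients of `P_lam` in the Fourier basis: `1` for the quadruples of frequencies that
lie in the top part of the spectrum and sum to zero, and `0` for all others. -/
def quadCoeff (lam : ℝ) (q : Fin 4 → Vertex ℓ) : ℝ :=
  open Classical in if (∀ i, lam ≤ G.symbol (q i)) ∧ ∑ i, q i = 0 then 1 else 0

theorem eval_topPoly_eq_sum (lam : ℝ) (f : Vertex ℓ → ℝ) :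
    MvPolynomial.eval f (G.topPoly lam) =
      ∑ q : Fin 4 → Vertex ℓ, G.quadCoeff lam q * ∏ i, fhat f (q i) := by
  classical
  rw [eval_topPoly]
  simp only [proj_apply, Fintype.sum_pow]
  rw [mean_sum]
  refine sum_congr rfl fun q _ => ?_
  rw [show (fun x => ∏ i, (if lam ≤ G.symbol (q i) then fhat f (q i) else 0) * chi (q i) x) =
    fun x => (∏ i, if lam ≤ G.symbol (q i) then fhat f (q i) else 0) * chi (∑ i, q i) x from ?_]
  · rw [mean_const_mul, mean_chi]
    simp only [quadCoeff]
    by_cases h : ∀ i, lam ≤ G.symbol (q i)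
    · simp [h, mul_comm]
    · obtain ⟨i, hi⟩ := not_forall.1 h
      rw [prod_eq_zero (mem_univ i) (by simp [hi])]
      simp [h]
  · funext x
    rw [prod_mul_distrib]
    congr 1
    simp [Fin.sum_univ_four, Fin.prod_univ_four, chi_add_left]

end CayleyGraph

/-! ### Edge averages and local Cheeger rounding -/

namespace CayleyGraph

variable (G : CayleyGraph ℓ)

/-- The expectation of `F x y` over a random edge: `x` is uniform and `y` is one step of the
random walk away from `x`. -/
def edgeMean (F : Vertex ℓ → Vertex ℓ → ℝ) : ℝ :=
  ∑ s, G.weight s * mean fun x => F x (x + s)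

theorem edgeMean_mono {F F' : Vertex ℓ → Vertex ℓ → ℝ} (h : ∀ x y, F x y ≤ F' x y) :
    G.edgeMean F ≤ G.edgeMean F' :=
  sum_le_sum fun s _ => mul_le_mul_of_nonneg_left (mean_mono fun _ => h _ _) (G.weight_nonneg s)

theorem edgeMean_add (F F' : Vertex ℓ → Vertex ℓ → ℝ) :
    G.edgeMean (fun x y => F x y + F' x y) = G.edgeMean F + G.edgeMean F' := by
  simp only [edgeMean, mean_add, mul_add, sum_add_distrib]

theorem edgeMean_const_mul (c : ℝ) (F : Vertex ℓ → Vertex ℓ → ℝ) :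
    G.edgeMean (fun x y => c * F x y) = c * G.edgeMean F := by
  simp only [edgeMean, mean_const_mul, mul_sum]
  exact sum_congr rfl fun s _ => by ring

theorem edgeMean_swap (F : Vertex ℓ → Vertex ℓ → ℝ) :
    G.edgeMean (fun x y => F y x) = G.edgeMean F := by
  refine sum_congr rfl fun s _ => ?_
  rw [← mean_comp_add _ s]
  simp only [vertex_add_add_cancel]

theorem edgeMean_fst (f : Vertex ℓ → ℝ) : G.edgeMean (fun x _ => f x) = mean f := by
  simp only [edgeMean, ← sum_mul, G.weight_sum, one_mul]

theorem edgeMean_snd (f : Vertex ℓ → ℝ) : G.edgeMean (fun _ y => f y) = mean f := by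
  rw [G.edgeMean_swap (fun x _ => f x), edgeMean_fst]

theorem edgeMean_mul (f g : Vertex ℓ → ℝ) :
    G.edgeMean (fun x y => f x * g y) = mean (fun x => f x * G.walk g x) := by
  simp only [edgeMean, walk_apply, mul_sum]
  rw [mean_sum]
  refine sum_congr rfl fun s _ => ?_
  rw [← mean_const_mul]
  congr 1; funext x; ring

theorem mean_mul_walk (f : Vertex ℓ → ℝ) :
    mean (fun x => f x * G.walk f x) = ∑ a, G.symbol a * fhat f a ^ 2 := by
  rw [mean_mul_eq_sum_fhat]
  exact sum_congr rfl fun a _ => by rw [fhat_walk]; ring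

/-- The indicator function of a vertex set. -/
def ind (U : Finset (Vertex ℓ)) (x : Vertex ℓ) : ℝ := if x ∈ U then 1 else 0

theorem measure_nonneg (U : Finset (Vertex ℓ)) : 0 ≤ measure U :=
  div_nonneg (Nat.cast_nonneg _) (Nat.cast_nonneg _)

theorem mean_ind (U : Finset (Vertex ℓ)) : mean (ind U) = measure U := by
  simp [mean, ind, measure, div_eq_inv_mul]

theorem edgeMean_ind_leave (U : Finset (Vertex ℓ)) :
    G.edgeMean (fun x y => ind U x * (1 - ind U y)) = measure U * G.expansion U := by
  rcases U.eq_empty_or_nonempty with rfl | hU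
  · simp [edgeMean, ind, measure, mean]
  have hc : (U.card : ℝ) ≠ 0 := by exact_mod_cast hU.card_pos.ne'
  have h : G.edgeMean (fun x y => ind U x * (1 - ind U y)) =
      (Fintype.card (Vertex ℓ) : ℝ)⁻¹ *
        ∑ x ∈ U, ∑ s, if x + s ∈ U then 0 else G.weight s := by
    simp only [edgeMean, mean, mul_sum]
    rw [sum_comm, ← sum_filter_add_sum_filter_not univ (· ∈ U)]
    rw [filter_univ_mem, sum_eq_zero (s := filter (· ∉ U) univ), add_zero]
    · refine sum_congr rfl fun x hx => sum_congr rfl fun s _ => ?_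
      by_cases hs : x + s ∈ U <;> simp [ind, hx, hs]
      ring
    · intro x hx
      simp [ind, (mem_filter.1 hx).2]
  rw [h, measure, expansion]
  field_simp

theorem edgeMean_abs_ind (U : Finset (Vertex ℓ)) :
    G.edgeMean (fun x y => |ind U x - ind U y|) = 2 * (measure U * G.expansion U) := by
  have : (fun x y : Vertex ℓ => |ind U x - ind U y|) = fun x y =>
      ind U x * (1 - ind U y) + ind U y * (1 - ind U x) := by
    funext x y
    by_cases hx : x ∈ U <;> by_cases hy : y ∈ U <;> simp [ind, hx, hy]
  rw [this, edgeMean_add, edgeMean_swap G (fun x y => ind U x * (1 - ind U y)),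
    edgeMean_ind_leave]
  ring

/-- The `ℓ₁` form of Cheeger's inequality, localized to functions supported in a set: if all
nonempty subsets of `S` expand, then functions supported in `S` vary a lot along edges. The
proof peels off the indicator of the support, scaled by the smallest positive value. -/
theorem mean_le_edgeMean_abs {η : ℝ} {S : Finset (Vertex ℓ)}
    (hS : ∀ U ⊆ S, U.Nonempty → η ≤ G.expansion U) (ψ : Vertex ℓ → ℝ) (hψ : ∀ x, 0 ≤ ψ x)
    (hsupp : ∀ x, x ∉ S → ψ x = 0) :
    2 * η * mean ψ ≤ G.edgeMean (fun x y => |ψ x - ψ y|) := by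
  induction hk : (univ.filter fun x => 0 < ψ x).card using Nat.strong_induction_on
    generalizing ψ with
  | _ k ih =>
  set U := univ.filter fun x => 0 < ψ x with hU
  have memU : ∀ x, x ∈ U ↔ 0 < ψ x := fun x => by simp [hU]
  have notU : ∀ x, x ∉ U → ψ x = 0 := fun x hx =>
    le_antisymm (not_lt.1 fun h => hx ((memU x).2 h)) (hψ x)
  rcases U.eq_empty_or_nonempty with hE | hne
  · have h0 : ψ = fun _ => 0 := funext fun x => notU x (by simp [hE])
    rw [h0, mean_const]
    simp [edgeMean, mean]
  obtain ⟨z, hz, hmin⟩ := exists_min_image U ψ hne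
  have hc : 0 < ψ z := (memU z).1 hz
  set φ : Vertex ℓ → ℝ := fun x => ψ x - ψ z * ind U x with hφ
  have hψφ : ∀ x, ψ x = φ x + ψ z * ind U x := fun x => by simp only [hφ]; ring
  have hφ0 : ∀ x, x ∉ U → φ x = 0 := fun x hx => by simp [hφ, ind, hx, notU x hx]
  have hφnn : ∀ x, 0 ≤ φ x := fun x => by
    by_cases hx : x ∈ U
    · have := hmin x hx
      simp only [hφ, ind, hx, if_true]; linarith
    · exact (hφ0 x hx).ge
  have hUS : U ⊆ S := fun x hx => by
    by_contra hxS
    have := (memU x).1 hx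
    rw [hsupp x hxS] at this
    exact lt_irrefl _ this
  have hcard : (univ.filter fun x => 0 < φ x).card < k := by
    rw [← hk]
    refine card_lt_card ⟨fun x hx => ?_, fun hsub => ?_⟩
    · by_contra hxU
      have := (mem_filter.1 hx).2
      rw [hφ0 x hxU] at this
      exact lt_irrefl _ this
    · have := (mem_filter.1 (hsub hz)).2
      simp [hφ, ind, hz] at this
  have hih := ih _ hcard φ hφnn (fun x hx => hφ0 x fun h => hx (hUS h)) rfl
  have habs : (fun x y => |ψ x - ψ y|) = fun x y =>
      |φ x - φ y| + ψ z * |ind U x - ind U y| := by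
    funext x y
    rw [hψφ x, hψφ y]
    have hx' := hφnn x
    have hy' := hφnn y
    by_cases hx : x ∈ U <;> by_cases hy : y ∈ U
    · simp [ind, hx, hy]
    · simp only [ind, hx, hy, hφ0 y hy, if_true, if_false]
      rw [abs_of_nonneg (by linarith), abs_of_nonneg (by linarith), abs_of_nonneg (by norm_num)]
      ring
    · simp only [ind, hx, hy, hφ0 x hx, if_true, if_false]
      rw [abs_of_nonpos (by linarith), abs_of_nonpos (by linarith), abs_of_nonpos (by norm_num)]
      ring
    · simp [ind, hx, hy]
  have hmean : mean ψ = mean φ + ψ z * measure U := by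
    rw [← mean_ind, ← mean_const_mul, ← mean_add]
    exact congrArg mean (funext hψφ)
  have hexp := hS U hUS hne
  have hm : 0 ≤ ψ z * measure U := mul_nonneg hc.le (measure_nonneg U)
  rw [habs, edgeMean_add, edgeMean_const_mul, edgeMean_abs_ind, hmean]
  nlinarith [mul_le_mul_of_nonneg_left hexp hm]

/-! ### The value in the Yes case -/

/-- A small non-expanding set gives a unit vector with large projected fourth moment: the
normalized indicator keeps half of its squared norm under the projection, and its projection
correlates with a small set. -/
theorem exists_eval_topPoly_ge {μ ε : ℝ} (hμ : 0 < μ) (hε : 0 < ε) (h : G.YesCase μ ε) :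
    ∃ f : Vertex ℓ → ℝ, mean (fun x => f x ^ 2) = 1 ∧
      1 / (16 * μ) ≤ MvPolynomial.eval f (G.topPoly (1 - 2 * ε)) := by
  classical
  obtain ⟨U, hne, hmeas, hexp⟩ := h
  have hδ : 0 < measure U := by
    unfold measure
    have := hne.card_pos
    have := card_vertex_pos (ℓ := ℓ)
    positivity
  set δ := measure U with hδdef
  set a := (Real.sqrt δ)⁻¹ with ha
  have ha2 : a ^ 2 * δ = 1 := by
    rw [ha, inv_pow, Real.sq_sqrt hδ.le, inv_mul_cancel₀ hδ.ne']
  have ind_sq : ∀ x : Vertex ℓ, ind U x ^ 2 = ind U x := fun x => by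
    unfold ind; split_ifs <;> norm_num
  set f : Vertex ℓ → ℝ := fun x => a * ind U x with hf
  have hf2 : mean (fun x => f x ^ 2) = 1 := by
    rw [← ha2, hδdef, ← mean_ind, ← mean_const_mul]
    exact congrArg mean (funext fun x => by rw [hf]; dsimp only; rw [mul_pow, ind_sq])
  refine ⟨f, hf2, ?_⟩
  have hwalk : 1 - ε ≤ ∑ b, G.symbol b * fhat f b ^ 2 := by
    rw [← mean_mul_walk, ← edgeMean_mul]
    have : (fun x y => f x * f y) = fun x y =>
        a ^ 2 * ind U x + (-a ^ 2) * (ind U x * (1 - ind U y)) := by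
      funext x y; simp only [hf]; ring
    rw [this, edgeMean_add, edgeMean_const_mul, edgeMean_const_mul, edgeMean_fst, mean_ind,
      edgeMean_ind_leave]
    nlinarith
  set g := G.proj (1 - 2 * ε) f with hg
  have hcorr : 1 / 2 ≤ mean (fun x => f x * g x) := by
    have h1 : mean (fun x => f x * g x) =
        ∑ b, if 1 - 2 * ε ≤ G.symbol b then fhat f b ^ 2 else 0 := by
      rw [mean_mul_eq_sum_fhat]
      refine sum_congr rfl fun b _ => ?_
      rw [hg, fhat_proj]
      split_ifs <;> ring
    have h2 : ∀ b, G.symbol b * fhat f b ^ 2 ≤ (1 - 2 * ε) * fhat f b ^ 2 +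
        2 * ε * (if 1 - 2 * ε ≤ G.symbol b then fhat f b ^ 2 else 0) := by
      intro b
      have := G.symbol_le_one b
      split_ifs with hb
      · nlinarith [sq_nonneg (fhat f b)]
      · nlinarith [sq_nonneg (fhat f b)]
    have h3 := sum_le_sum fun b (_ : b ∈ (univ : Finset (Vertex ℓ))) => h2 b
    rw [sum_add_distrib, ← mul_sum, ← mul_sum, ← h1, ← mean_sq_eq_sum_fhat, hf2] at h3
    nlinarith
  rw [eval_topPoly, ← hg]
  set T := mean (fun x => g x ^ 4) with hT
  set S := ∑ x ∈ U, g x with hS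
  have hn := card_vertex_pos (ℓ := ℓ)
  set n : ℝ := (Fintype.card (Vertex ℓ) : ℝ)
  have hcorr2 : mean (fun x => f x * g x) = n⁻¹ * (a * S) := by
    rw [mean]
    congr 1
    rw [hS, mul_sum, ← sum_filter_add_sum_filter_not univ (· ∈ U), filter_univ_mem,
      sum_eq_zero (s := filter (· ∉ U) univ), add_zero]
    · exact sum_congr rfl fun x hx => by simp [hf, ind, hx]
    · intro x hx
      simp [hf, ind, (mem_filter.1 hx).2]
  have hUn : (U.card : ℝ) = δ * n := by rw [hδdef, measure, div_mul_cancel₀ _ hn.ne']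
  -- two applications of Cauchy–Schwarz play the role of Hölder's inequality
  have hS4 : S ^ 4 ≤ (δ * n) ^ 3 * (n * T) := by
    have h1 : S ^ 2 ≤ U.card * ∑ x ∈ U, g x ^ 2 := sq_sum_le_card_mul_sum_sq
    have h2 : (∑ x ∈ U, g x ^ 2) ^ 2 ≤ U.card * ∑ x ∈ U, (g x ^ 2) ^ 2 :=
      sq_sum_le_card_mul_sum_sq
    have h3 : ∑ x ∈ U, (g x ^ 2) ^ 2 ≤ n * T := by
      rw [hT, mean, mul_inv_cancel_left₀ hn.ne']
      refine (sum_le_sum_of_subset_of_nonneg (subset_univ U) fun x _ _ => by positivity).trans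
        (le_of_eq (sum_congr rfl fun x _ => by ring))
    rw [hUn] at h1 h2
    have hδn : 0 ≤ δ * n := by positivity
    calc S ^ 4 = (S ^ 2) ^ 2 := by ring
      _ ≤ (δ * n * ∑ x ∈ U, g x ^ 2) ^ 2 := pow_le_pow_left₀ (sq_nonneg _) h1 2
      _ = (δ * n) ^ 2 * (∑ x ∈ U, g x ^ 2) ^ 2 := by ring
      _ ≤ (δ * n) ^ 2 * (δ * n * (n * T)) := by
        refine mul_le_mul_of_nonneg_left (h2.trans ?_) (by positivity)
        exact mul_le_mul_of_nonneg_left h3 hδn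
      _ = _ := by ring
  have h16 : 1 / 16 ≤ (n⁻¹ * (a * S)) ^ 4 := by
    rw [hcorr2] at hcorr
    calc (1 / 16 : ℝ) = (1 / 2) ^ 4 := by norm_num
      _ ≤ _ := pow_le_pow_left₀ (by norm_num) hcorr 4
  have hfin : 1 / 16 ≤ δ * T := by
    refine h16.trans ?_
    calc (n⁻¹ * (a * S)) ^ 4 = n⁻¹ ^ 4 * a ^ 4 * S ^ 4 := by ring
      _ ≤ n⁻¹ ^ 4 * a ^ 4 * ((δ * n) ^ 3 * (n * T)) :=
        mul_le_mul_of_nonneg_left hS4 (by positivity)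
      _ = (n⁻¹ * n) ^ 4 * (a ^ 2 * δ) ^ 2 * (δ * T) := by ring
      _ = δ * T := by rw [ha2, inv_mul_cancel₀ hn.ne']; ring
  have hT0 : 0 ≤ T := mean_nonneg fun x => by positivity
  rw [div_le_iff₀ (by positivity)]
  nlinarith [mul_le_mul_of_nonneg_right hmeas hT0]

end CayleyGraph

/-- The relaxation is at least the value of the polynomial at any point of the sphere. -/
theorem eval_le_sosValue {ι : Type*} [Fintype ι] (d : ℕ) (P : MvPolynomial ι ℝ) (f : ι → ℝ)
    (hf : mean (fun i => f i ^ 2) = 1) :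
    ((MvPolynomial.eval f P : ℝ) : EReal) ≤ sosValue d P := by
  refine le_sSup ⟨⟨(MvPolynomial.aeval f).toLinearMap, by simp, fun p _ => ?_⟩, ?_, ?_⟩
  · simp only [AlgHom.toLinearMap_apply, map_pow]
    positivity
  · have : MvPolynomial.eval f (normSqPoly ι) = 1 := by
      rw [← hf]; simp [normSqPoly, mean]
    simp [PseudoExpectation.Consistent, MvPolynomial.aeval_eq_eval, this]
  · simp [MvPolynomial.aeval_eq_eval]

/-! ### The true maximum in the No case -/

namespace CayleyGraph

variable (G : CayleyGraph ℓ)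

theorem proj_eq_self {lam : ℝ} {f : Vertex ℓ → ℝ}
    (hf : ∀ a, G.symbol a < lam → fhat f a = 0) : G.proj lam f = f := by
  classical
  funext x
  rw [proj_apply]
  refine Eq.trans (sum_congr rfl fun a _ => ?_) (fourier_inversion f x)
  split_ifs with h
  · rfl
  · rw [hf a (not_le.1 h)]

theorem mean_proj_sq_le (lam : ℝ) (f : Vertex ℓ → ℝ) :
    mean (fun x => G.proj lam f x ^ 2) ≤ mean fun x => f x ^ 2 := by
  classical
  rw [mean_sq_eq_sum_fhat, mean_sq_eq_sum_fhat]
  refine sum_le_sum fun a _ => ?_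
  rw [fhat_proj]
  split_ifs <;> nlinarith [sq_nonneg (fhat f a)]

theorem eval_topPoly_smul (lam c : ℝ) (f : Vertex ℓ → ℝ) :
    MvPolynomial.eval (c • f) (G.topPoly lam) = c ^ 4 * MvPolynomial.eval f (G.topPoly lam) := by
  simp only [eval_topPoly_eq_sum, fhat_smul, prod_mul_distrib, mul_sum]
  refine sum_congr rfl fun q _ => ?_
  simp
  ring

theorem isCompact_sphere :
    IsCompact {f : Vertex ℓ → ℝ | mean (fun x => f x ^ 2) = 1} := by
  have hn := card_vertex_pos (ℓ := ℓ)
  refine Metric.isCompact_of_isClosed_isBounded ?_ ?_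
  · refine isClosed_eq ?_ continuous_const
    unfold mean
    fun_prop
  · refine (Metric.isBounded_closedBall (x := (0 : Vertex ℓ → ℝ))
      (r := (Fintype.card (Vertex ℓ) : ℝ) + 1)).subset fun f hf => ?_
    rw [mem_closedBall_zero_iff, pi_norm_le_iff_of_nonneg (by positivity)]
    intro x
    have hf : mean (fun x => f x ^ 2) = 1 := hf
    rw [mean, inv_mul_eq_iff_eq_mul₀ hn.ne', mul_one] at hf
    have h1 : f x ^ 2 ≤ Fintype.card (Vertex ℓ) := by
      rw [← hf]
      exact single_le_sum (f := fun x => f x ^ 2) (fun y _ => sq_nonneg _) (mem_univ x)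
    rw [Real.norm_eq_abs]
    exact abs_le_of_sq_le_sq (by nlinarith) (by positivity)

/-- The polynomial `P_lam` attains its maximum over the unit sphere. -/
theorem exists_max_topPoly (lam : ℝ) :
    ∃ f : Vertex ℓ → ℝ, mean (fun x => f x ^ 2) = 1 ∧ ∀ h : Vertex ℓ → ℝ,
      MvPolynomial.eval h (G.topPoly lam) ≤
        MvPolynomial.eval f (G.topPoly lam) * mean (fun x => h x ^ 2) ^ 2 := by
  obtain ⟨f, hf, hmax⟩ := (isCompact_sphere (ℓ := ℓ)).exists_isMaxOn
    ⟨fun _ => 1, by simp [mean_const]⟩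
    (MvPolynomial.continuous_eval (G.topPoly lam)).continuousOn
  refine ⟨f, hf, fun h => ?_⟩
  set N := mean (fun x => h x ^ 2) with hN
  have hN0 : 0 ≤ N := mean_nonneg fun x => sq_nonneg _
  rcases hN0.eq_or_lt with h0 | hpos
  · have : h = 0 := by
      rw [← fhat_eq_zero_iff]
      intro a
      have hs : ∑ a, fhat h a ^ 2 = 0 := by rw [← mean_sq_eq_sum_fhat, ← hN, ← h0]
      exact pow_eq_zero_iff two_ne_zero |>.1
        ((sum_eq_zero_iff_of_nonneg fun a _ => sq_nonneg _).1 hs a (mem_univ a))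
    rw [this, ← h0, ← zero_smul ℝ (0 : Vertex ℓ → ℝ), eval_topPoly_smul]
    simp
  · set c := (Real.sqrt N)⁻¹ with hc
    have hc2 : c ^ 2 * N = 1 := by
      rw [hc, inv_pow, Real.sq_sqrt hN0, inv_mul_cancel₀ hpos.ne']
    have hmem : c • h ∈ {f : Vertex ℓ → ℝ | mean (fun x => f x ^ 2) = 1} := by
      change mean (fun x => (c • h) x ^ 2) = 1
      simp only [Pi.smul_apply, smul_eq_mul, mul_pow, mean_const_mul]
      exact hc2
    have h1 : MvPolynomial.eval (c • h) (G.topPoly lam) ≤ MvPolynomial.eval f (G.topPoly lam) :=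
      hmax hmem
    rw [eval_topPoly_smul] at h1
    calc MvPolynomial.eval h (G.topPoly lam)
        = (c ^ 2 * N) ^ 2 * MvPolynomial.eval h (G.topPoly lam) := by rw [hc2]; ring
      _ = N ^ 2 * (c ^ 4 * MvPolynomial.eval h (G.topPoly lam)) := by ring
      _ ≤ N ^ 2 * MvPolynomial.eval f (G.topPoly lam) :=
        mul_le_mul_of_nonneg_left h1 (by positivity)
      _ = _ := by ring

/-- If `P_lam` is maximal on the unit sphere at `f`, then the projection `g` of `f` is nearly fixed
by the random walk in the fourth norm: the vector `g - G g` lies in the top space and has small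
second norm, so maximality controls its fourth norm. -/
theorem mean_cube_mul_walk_ge {τ : ℝ} (hτ : 0 < τ) {f : Vertex ℓ → ℝ}
    (hf : mean (fun x => f x ^ 2) = 1)
    (hmax : ∀ h : Vertex ℓ → ℝ, MvPolynomial.eval h (G.topPoly (1 - τ)) ≤
        MvPolynomial.eval f (G.topPoly (1 - τ)) * mean (fun x => h x ^ 2) ^ 2) :
    (1 - τ) * mean (fun x => G.proj (1 - τ) f x ^ 4) ≤
      mean fun x => G.proj (1 - τ) f x ^ 3 * G.walk (G.proj (1 - τ) f) x := by
  classical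
  set g := G.proj (1 - τ) f with hg
  set T := mean (fun x => g x ^ 4) with hT
  have hT0 : 0 ≤ T := mean_nonneg fun x => by positivity
  have hTe : MvPolynomial.eval f (G.topPoly (1 - τ)) = T := by rw [eval_topPoly]
  rw [hTe] at hmax
  -- the error vector, rescaled to have second norm at most `1`
  set e : Vertex ℓ → ℝ := τ⁻¹ • (g - G.walk g) with he
  have hehat : ∀ a, fhat e a =
      τ⁻¹ * ((1 - G.symbol a) * if 1 - τ ≤ G.symbol a then fhat f a else 0) := fun a => by
    rw [he, fhat_smul, fhat_sub, fhat_walk, hg, fhat_proj]; ring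
  have hproj : G.proj (1 - τ) e = e := G.proj_eq_self fun a ha => by
    rw [hehat, if_neg (not_le.2 ha)]; ring
  have he2 : mean (fun x => e x ^ 2) ≤ 1 := by
    rw [← hf, mean_sq_eq_sum_fhat, mean_sq_eq_sum_fhat]
    refine sum_le_sum fun a _ => ?_
    rw [hehat]
    split_ifs with h
    · have h1 := G.symbol_le_one a
      have h2 : 0 ≤ τ⁻¹ * (1 - G.symbol a) := mul_nonneg (by positivity) (by linarith)
      have h3 : τ⁻¹ * (1 - G.symbol a) ≤ 1 := by
        rw [inv_mul_le_iff₀ hτ]; linarith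
      have h4 : (τ⁻¹ * (1 - G.symbol a)) ^ 2 ≤ 1 := pow_le_one₀ h2 h3
      calc (τ⁻¹ * ((1 - G.symbol a) * fhat f a)) ^ 2
          = (τ⁻¹ * (1 - G.symbol a)) ^ 2 * fhat f a ^ 2 := by ring
        _ ≤ 1 * fhat f a ^ 2 := mul_le_mul_of_nonneg_right h4 (sq_nonneg _)
        _ = _ := one_mul _
    · simpa using sq_nonneg (fhat f a)
  have he4 : mean (fun x => e x ^ 4) ≤ T := by
    have h1 := hmax e
    rw [eval_topPoly, hproj] at h1
    refine h1.trans (mul_le_of_le_one_right hT0 (pow_le_one₀ ?_ he2))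
    exact mean_nonneg fun x => sq_nonneg _
  have hyoung : mean (fun x => g x ^ 3 * e x) ≤ T := by
    have h1 : mean (fun x => g x ^ 3 * e x) ≤
        mean (fun x => 3 / 4 * g x ^ 4 + 1 / 4 * e x ^ 4) := by
      refine mean_mono fun x => ?_
      nlinarith [sq_nonneg (g x ^ 2 - g x * e x), sq_nonneg (g x ^ 2 - e x ^ 2),
        sq_nonneg (g x * (g x - e x)), mul_nonneg (sq_nonneg (g x - e x))
          (add_nonneg (sq_nonneg (g x)) (sq_nonneg (g x + e x)))]
    rw [mean_add, mean_const_mul, mean_const_mul] at h1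
    linarith
  have hsplit : (fun x => g x ^ 3 * G.walk g x) =
      fun x => g x ^ 4 - τ * (g x ^ 3 * e x) := by
    funext x
    simp only [he, Pi.smul_apply, Pi.sub_apply, smul_eq_mul]
    field_simp
    ring
  rw [hsplit, mean_sub, mean_const_mul]
  nlinarith

/-- Small-set expansion bounds the fourth norm on the top space: the square of the projection of
a maximizer varies little along the edges in the first-order sense, so a level set of it would
otherwise be small and non-expanding. -/
theorem eval_topPoly_le_of_noCase {δ τ : ℝ} (hδ : 0 < δ) (hτ : 0 < τ) (hτ' : τ ≤ 1 / 50)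
    (hno : G.NoCase δ (1 / 2)) (h : Vertex ℓ → ℝ) (hh : mean (fun x => h x ^ 2) = 1) :
    MvPolynomial.eval h (G.topPoly (1 - τ)) ≤ 2 / δ := by
  obtain ⟨f, hf, hmax⟩ := G.exists_max_topPoly (1 - τ)
  refine (hmax h).trans ?_
  rw [hh, one_pow, mul_one, eval_topPoly]
  have hcube := G.mean_cube_mul_walk_ge hτ hf hmax
  have hg2 := (G.mean_proj_sq_le (1 - τ) f).trans hf.le
  set g := G.proj (1 - τ) f
  set T := mean (fun x => g x ^ 4) with hT
  have hT0 : 0 ≤ T := mean_nonneg fun x => by positivity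
  -- the threshold below which levels are discarded
  set s := 1 / δ with hs
  have hspos : 0 < s := by positivity
  set ψ : Vertex ℓ → ℝ := fun x => max (g x ^ 4 - s ^ 2) 0 with hψ
  set S : Finset (Vertex ℓ) := univ.filter fun x => s ≤ g x ^ 2 with hS
  have hSmeas : measure S ≤ δ := by
    have h1 : s * measure S ≤ 1 := by
      refine le_trans ?_ hg2
      rw [← mean_ind, ← mean_const_mul]
      refine mean_mono fun x => ?_
      unfold ind
      split_ifs with hx
      · rw [mul_one]; exact (mem_filter.1 hx).2
      · rw [mul_zero]; positivity
    rw [hs, one_div, inv_mul_le_iff₀ hδ] at h1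
    linarith
  have hcheeger : 2 * (1 / 2) * mean ψ ≤ G.edgeMean (fun x y => |ψ x - ψ y|) := by
    refine G.mean_le_edgeMean_abs (S := S) (fun U hU hne => hno U hne ?_) ψ
      (fun x => le_max_right _ _) fun x hx => ?_
    · refine le_trans ?_ hSmeas
      unfold measure
      gcongr
    · have hx : g x ^ 2 < s := by simpa [hS] using hx
      refine max_eq_right ?_
      nlinarith [sq_nonneg (g x)]
  have hψT : T - s ≤ mean ψ := by
    have h1 : mean (fun x => g x ^ 4 - s * g x ^ 2) ≤ mean ψ := by
      refine mean_mono fun x => ?_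
      rcases le_total s (g x ^ 2) with hx | hx
      · refine le_trans ?_ (le_max_left _ _)
        nlinarith
      · refine le_trans ?_ (le_max_right _ _)
        nlinarith [sq_nonneg (g x)]
    rw [mean_sub, mean_const_mul] at h1
    nlinarith
  have hvar : G.edgeMean (fun x y => |ψ x - ψ y|) ≤
      G.edgeMean (fun x y => (16 / 3 + 1 / 8) * (g x ^ 4 + g y ^ 4) +
        (-16 / 3) * (g x ^ 3 * g y + g y ^ 3 * g x)) := by
    refine G.edgeMean_mono fun x y => ?_
    have h1 : |ψ x - ψ y| ≤ |g x ^ 4 - g y ^ 4| := by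
      have := abs_max_sub_max_le_abs (g x ^ 4 - s ^ 2) (g y ^ 4 - s ^ 2) 0
      simpa [hψ] using this
    refine h1.trans ?_
    generalize g x = a
    generalize g y = b
    -- weighted arithmetic–geometric mean inequality
    have h2 : |a ^ 4 - b ^ 4| ≤ 4 * (a ^ 2 - b ^ 2) ^ 2 + 1 / 16 * (a ^ 2 + b ^ 2) ^ 2 := by
      rw [abs_le]
      constructor
      · nlinarith [sq_nonneg (2 * (a ^ 2 - b ^ 2) + 1 / 4 * (a ^ 2 + b ^ 2))]
      · nlinarith [sq_nonneg (2 * (a ^ 2 - b ^ 2) - 1 / 4 * (a ^ 2 + b ^ 2))]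
    nlinarith [sq_nonneg (a ^ 2 - b ^ 2), sq_nonneg ((a - b) ^ 2)]
  rw [edgeMean_add, edgeMean_const_mul, edgeMean_const_mul, edgeMean_add, edgeMean_add,
    edgeMean_fst G (fun x => g x ^ 4), edgeMean_snd G (fun x => g x ^ 4),
    edgeMean_swap G (fun x y => g x ^ 3 * g y), edgeMean_mul G (fun x => g x ^ 3)] at hvar
  have h2s : 2 / δ = 2 * s := by rw [hs]; ring
  rw [h2s]
  nlinarith

end CayleyGraph

/-! ### The spectral norm and a representation with nonnegative coefficients -/

theorem exists_quadNorm_bound {κ : Type*} [Fintype κ] [Nonempty κ]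
    (Q : QuadraticForm ℝ (κ → ℝ)) :
    ∃ c : ℝ, 0 ≤ c ∧ ∀ F : κ → ℝ, |Q F| ≤ c * mean (fun i => F i ^ 2) := by
  classical
  set B := QuadraticMap.associated (R := ℝ) Q
  set b : κ → κ → ℝ := fun i j => B (fun k => if i = k then 1 else 0) fun k => if j = k then 1 else 0
  have hn : (0 : ℝ) < Fintype.card κ := by exact_mod_cast Fintype.card_pos
  refine ⟨Fintype.card κ * ∑ i, ∑ j, |b i j|, by positivity, fun F => ?_⟩
  have hQ : Q F = ∑ i, ∑ j, F i * (F j * b i j) := by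
    rw [← QuadraticMap.associated_eq_self_apply ℝ Q F]
    change B F F = _
    rw [LinearMap.pi_apply_eq_sum_univ (B F) F, sum_comm]
    refine sum_congr rfl fun i _ => ?_
    rw [← LinearMap.flip_apply, LinearMap.pi_apply_eq_sum_univ (B.flip _) F, smul_eq_mul,
      mul_sum]
    refine sum_congr rfl fun j _ => ?_
    simp only [LinearMap.flip_apply, smul_eq_mul, b]
    ring
  have hF : ∀ i, F i ^ 2 ≤ ∑ k, F k ^ 2 := fun i =>
    single_le_sum (f := fun k => F k ^ 2) (fun k _ => sq_nonneg _) (mem_univ i)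
  rw [mean, hQ, mul_comm (Fintype.card κ : ℝ), mul_assoc, mul_inv_cancel_left₀ hn.ne', sum_mul]
  refine (abs_sum_le_sum_abs _ _).trans (sum_le_sum fun i _ => ?_)
  rw [sum_mul]
  refine (abs_sum_le_sum_abs _ _).trans (sum_le_sum fun j _ => ?_)
  rw [← mul_assoc, abs_mul, mul_comm]
  refine mul_le_mul_of_nonneg_left ?_ (abs_nonneg _)
  rw [abs_le]
  constructor <;> nlinarith [hF i, hF j, sq_nonneg (F i + F j), sq_nonneg (F i - F j)]

namespace CayleyGraph

variable (G : CayleyGraph ℓ)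

theorem exists_quadraticForm_topPoly (lam : ℝ) :
    ∃ Q : QuadraticForm ℝ (Vertex ℓ × Vertex ℓ → ℝ),
      ∀ f : Vertex ℓ → ℝ, Q (tensorSq f) = MvPolynomial.eval f (G.topPoly lam) := by
  set l : Vertex ℓ → (Vertex ℓ × Vertex ℓ → ℝ) →ₗ[ℝ] ℝ := fun x =>
    ∑ p : Vertex ℓ × Vertex ℓ, (G.proj lam (Pi.single p.1 1) x * G.proj lam (Pi.single p.2 1) x) •
      LinearMap.proj p with hl
  refine ⟨(Fintype.card (Vertex ℓ) : ℝ)⁻¹ • ∑ x, (QuadraticMap.sq (R := ℝ)).comp (l x),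
    fun f => ?_⟩
  rw [eval_topPoly, mean, _root_.smul_apply, _root_.sum_apply, smul_eq_mul]
  congr 1
  refine sum_congr rfl fun x _ => ?_
  have : l x (tensorSq f) = G.proj lam f x ^ 2 := by
    rw [← sum_proj_single, sq, sum_mul_sum, hl]
    simp only [LinearMap.sum_apply, LinearMap.smul_apply, LinearMap.proj_apply, smul_eq_mul,
      tensorSq]
    rw [Fintype.sum_prod_type]
    exact sum_congr rfl fun y _ => sum_congr rfl fun z _ => by ring
  rw [QuadraticMap.comp_apply, this, QuadraticMap.sq_apply]
  ring

/-- The constant function is an eigenfunction with eigenvalue `1`, so `K ≥ 1`. -/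
theorem one_le_specK {lam : ℝ} (hlam : lam ≤ 1) : 1 ≤ G.specK lam := by
  obtain ⟨Q₀, hQ₀⟩ := G.exists_quadraticForm_topPoly lam
  refine le_csInf ⟨_, Q₀, hQ₀, rfl⟩ ?_
  rintro _ ⟨Q, hQ, rfl⟩
  refine le_csInf (exists_quadNorm_bound Q) ?_
  rintro c ⟨-, hc⟩
  have hone : ∀ a : Vertex ℓ, a ≠ 0 → fhat (fun _ => 1) a = 0 := fun a ha => by
    have := mean_chi a
    rw [if_neg ha] at this
    simpa [fhat] using this
  have h1 : G.proj lam (fun _ => 1) = fun _ => 1 := G.proj_eq_self fun a ha => by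
    refine hone a ?_
    rintro rfl
    rw [symbol_zero] at ha
    linarith
  have h2 := hc (tensorSq fun _ => 1)
  have hn : (Fintype.card (Vertex ℓ × Vertex ℓ) : ℝ) ≠ 0 := by
    exact_mod_cast Fintype.card_ne_zero
  rw [hQ, eval_topPoly, h1] at h2
  simp only [tensorSq, one_pow, mul_one, mean_const, abs_one] at h2
  rwa [mean, sum_const, card_univ, nsmul_eq_mul, mul_one, inv_mul_cancel₀ hn, mul_one] at h2

theorem exists_quadraticForm_le {lam : ℝ} (hlam : lam ≤ 1) :
    ∃ Q : QuadraticForm ℝ (Vertex ℓ × Vertex ℓ → ℝ),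
      (∀ f : Vertex ℓ → ℝ, Q (tensorSq f) = MvPolynomial.eval f (G.topPoly lam)) ∧
      ∀ F, |Q F| ≤ 2 * G.specK lam * mean (fun i => F i ^ 2) := by
  have hK := G.one_le_specK hlam
  obtain ⟨Q₀, hQ₀⟩ := G.exists_quadraticForm_topPoly lam
  have hlt : polySpectralNorm (G.topPoly lam) < 2 * G.specK lam := by
    change G.specK lam < _
    linarith
  obtain ⟨_, ⟨Q, hQ, rfl⟩, hlt⟩ := exists_lt_of_csInf_lt
    (s := {c : ℝ | ∃ Q : QuadraticForm ℝ (Vertex ℓ × Vertex ℓ → ℝ),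
      (∀ f : Vertex ℓ → ℝ, Q (tensorSq f) = MvPolynomial.eval f (G.topPoly lam)) ∧
        c = quadNorm Q}) ⟨_, Q₀, hQ₀, rfl⟩ hlt
  obtain ⟨c, ⟨-, hc⟩, hlt'⟩ := exists_lt_of_csInf_lt (exists_quadNorm_bound Q) hlt
  exact ⟨Q, hQ, fun F => (hc F).trans
    (mul_le_mul_of_nonneg_right hlt'.le (mean_nonneg fun i => sq_nonneg _))⟩

end CayleyGraph

/-- The character `χ_a ⊗ χ_b` on pairs of vertices. -/
def chiTensor (p : Vertex ℓ × Vertex ℓ) : Vertex ℓ × Vertex ℓ → ℝ :=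
  fun x => chi p.1 x.1 * chi p.2 x.2

theorem mean_prod (f g : Vertex ℓ → ℝ) :
    mean (fun x : Vertex ℓ × Vertex ℓ => f x.1 * g x.2) = mean f * mean g := by
  simp only [mean, Fintype.card_prod, Nat.cast_mul, Fintype.sum_prod_type, ← mul_sum, ← sum_mul]
  rw [mul_inv]; ring

theorem mean_chiTensor_mul (p r : Vertex ℓ × Vertex ℓ) :
    mean (fun x => chiTensor p x * chiTensor r x) = if p = r then 1 else 0 := by
  have : (fun x => chiTensor p x * chiTensor r x) = fun x : Vertex ℓ × Vertex ℓ =>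
      (chi p.1 x.1 * chi r.1 x.1) * (chi p.2 x.2 * chi r.2 x.2) := by
    funext x; simp only [chiTensor]; ring
  rw [this, mean_prod (fun y => chi p.1 y * chi r.1 y) (fun y => chi p.2 y * chi r.2 y),
    mean_chi_mul_chi, mean_chi_mul_chi]
  by_cases h1 : p.1 = r.1 <;> by_cases h2 : p.2 = r.2 <;> simp [Prod.ext_iff, h1, h2]

theorem mean_sum_chiTensor_sq (m : Vertex ℓ × Vertex ℓ → ℝ) :
    mean (fun x => (∑ p, m p • chiTensor p) x ^ 2) = ∑ p, m p ^ 2 := by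
  have : (fun x => (∑ p, m p • chiTensor p) x ^ 2) = fun x : Vertex ℓ × Vertex ℓ =>
      ∑ p, ∑ r, m p * m r * (chiTensor p x * chiTensor r x) := by
    funext x
    simp only [Finset.sum_apply, Pi.smul_apply, smul_eq_mul, sq, sum_mul_sum]
    exact sum_congr rfl fun p _ => sum_congr rfl fun r _ => by ring
  rw [this, mean_sum]
  refine sum_congr rfl fun p _ => ?_
  rw [mean_sum]
  simp only [mean_const_mul, mean_chiTensor_mul]
  simp [sq]

/-- The square sum of every row of a bilinear form in the orthonormal basis of characters is at
most the square of the spectral norm. -/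
theorem sum_associated_sq_le {Q : QuadraticForm ℝ (Vertex ℓ × Vertex ℓ → ℝ)} {c : ℝ} (hc : 0 < c)
    (hQ : ∀ F, |Q F| ≤ c * mean (fun i => F i ^ 2)) (p : Vertex ℓ × Vertex ℓ) :
    ∑ r, QuadraticMap.associated (R := ℝ) Q (chiTensor p) (chiTensor r) ^ 2 ≤ c ^ 2 := by
  set B := QuadraticMap.associated (R := ℝ) Q
  set m : Vertex ℓ × Vertex ℓ → ℝ := fun r => B (chiTensor p) (chiTensor r) with hm
  set F := ∑ r, m r • chiTensor r with hF
  set S := ∑ r, m r ^ 2 with hS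
  have hBS : B (c • chiTensor p) F = c * S := by
    rw [map_smul, LinearMap.smul_apply, hF, map_sum, hS, smul_eq_mul]
    congr 1
    exact sum_congr rfl fun r _ => by rw [map_smul, smul_eq_mul, sq]
  have hFF : mean (fun x => F x ^ 2) = S := mean_sum_chiTensor_sq m
  have hpp : mean (fun x => (c • chiTensor p) x ^ 2) = c ^ 2 := by
    have := mean_chiTensor_mul p p
    simp only [Pi.smul_apply, smul_eq_mul, mul_pow, mean_const_mul]
    simp only [← sq, if_true] at this
    rw [this, mul_one]
  have hpol : Q (c • chiTensor p + F) - Q (c • chiTensor p - F) =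
      4 * B (c • chiTensor p) F := by
    have hsymm : ∀ x y, B x y = B y x := fun x y =>
      QuadraticMap.associated_isSymm ℝ Q x y
    rw [← QuadraticMap.associated_eq_self_apply ℝ Q (c • chiTensor p + F),
      ← QuadraticMap.associated_eq_self_apply ℝ Q (c • chiTensor p - F)]
    change B _ _ - B _ _ = _
    simp only [map_add, map_sub, LinearMap.add_apply, LinearMap.sub_apply]
    rw [hsymm F (c • chiTensor p)]
    ring
  have h1 := (abs_le.1 (hQ (c • chiTensor p + F))).2
  have h2 := (abs_le.1 (hQ (c • chiTensor p - F))).1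
  have h3 : mean (fun x => (c • chiTensor p + F) x ^ 2) +
      mean (fun x => (c • chiTensor p - F) x ^ 2) = 2 * (c ^ 2 + S) := by
    rw [← hpp, ← hFF, ← mean_add, ← mean_add, ← mean_const_mul]
    congr 1; funext x
    simp only [Pi.add_apply, Pi.sub_apply]; ring
  have h4 : 4 * (c * S) ≤ c * (2 * (c ^ 2 + S)) := by
    rw [← hBS, ← hpol, ← h3]; linarith
  have h5 : c * S ≤ c * c ^ 2 := by nlinarith
  exact le_of_mul_le_mul_left h5 hc

/-- A quadruple of frequencies, seen as a pair of pairs. -/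
def quadEquiv (V : Type*) : (Fin 4 → V) ≃ (V × V) × (V × V) where
  toFun q := ((q 0, q 1), (q 2, q 3))
  invFun r := ![r.1.1, r.1.2, r.2.1, r.2.2]
  left_inv q := by funext i; fin_cases i <;> rfl
  right_inv r := rfl

theorem sum_quad {V : Type*} [Fintype V] (F : V × V → V × V → ℝ) :
    ∑ q : Fin 4 → V, F (q 0, q 1) (q 2, q 3) = ∑ p, ∑ r, F p r := by
  rw [← Fintype.sum_prod_type']
  exact Fintype.sum_equiv (quadEquiv V) _ _ fun _ => rfl

theorem tensorSq_eq_sum (f : Vertex ℓ → ℝ) :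
    tensorSq f = ∑ p : Vertex ℓ × Vertex ℓ, (fhat f p.1 * fhat f p.2) • chiTensor p := by
  funext x
  simp only [tensorSq, Finset.sum_apply, Pi.smul_apply, smul_eq_mul, chiTensor]
  rw [← fourier_inversion f x.1, ← fourier_inversion f x.2, sum_mul_sum, Fintype.sum_prod_type]
  dsimp only
  exact sum_congr rfl fun a _ => sum_congr rfl fun b _ => by ring

/-- The exponent vector of the monomial `∏ i, X (q i)`. -/
def monoKey {V : Type*} (q : Fin 4 → V) : V →₀ ℕ := ∑ i, Finsupp.single (q i) 1

theorem prod_monoKey {V R : Type*} [CommSemiring R] (q : Fin 4 → V) (g : V → R) :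
    (monoKey q).prod (fun a k => g a ^ k) = ∏ i, g (q i) := by
  rw [monoKey, ← Finsupp.prod_finsetSum_index (fun _ => pow_zero _) (fun _ _ _ => pow_add _ _ _)]
  simp

/-- Quartic forms that agree as functions have the same coefficients at every monomial. -/
theorem sum_fiber_eq {V : Type*} [Fintype V] [DecidableEq V] (M M' : (Fin 4 → V) → ℝ)
    (h : ∀ u : V → ℝ, ∑ q, M q * ∏ i, u (q i) = ∑ q, M' q * ∏ i, u (q i)) (k : V →₀ ℕ) :
    (∑ q, if monoKey q = k then M q else 0) = ∑ q, if monoKey q = k then M' q else 0 := by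
  have hp : (∑ q, MvPolynomial.monomial (monoKey q) (M q)) =
      ∑ q, MvPolynomial.monomial (monoKey q) (M' q) := by
    refine MvPolynomial.funext fun u => ?_
    simpa only [map_sum, MvPolynomial.eval_monomial, prod_monoKey] using h u
  have := congrArg (MvPolynomial.coeff k) hp
  simpa [MvPolynomial.coeff_sum, MvPolynomial.coeff_monomial] using this

/-- Let `c` be a zero-one weight that is constant on the fibres of `k`, and let `M` have the same
fibre sums. Then the squares of `M` can be rescaled downwards, on each fibre, to nonnegative
weights with these fibre sums, because by Cauchy–Schwarz the sum of `M²` over a fibre is at least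
the sum of `M` whenever the latter is the size of the fibre. -/
theorem exists_nonneg_weights {X Y : Type*} [Fintype X] [DecidableEq Y] (k : X → Y) (M c : X → ℝ)
    (hc : ∀ q, c q = 0 ∨ c q = 1) (hk : ∀ q q', k q = k q' → c q = c q')
    (hM : ∀ y, (∑ q, if k q = y then M q else 0) = ∑ q, if k q = y then c q else 0) :
    ∃ N : X → ℝ, (∀ q, 0 ≤ N q) ∧ (∀ q, N q ≤ M q ^ 2) ∧
      ∀ t : Y → ℝ, ∑ q, N q * t (k q) = ∑ q, c q * t (k q) := by
  set size : X → ℝ := fun q => ∑ q', if k q' = k q then 1 else 0 with hsize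
  set sq : X → ℝ := fun q => ∑ q', if k q' = k q then M q' ^ 2 else 0 with hsq
  have hsize_pos : ∀ q, 0 < size q := fun q => by
    have : (if k q = k q then (1 : ℝ) else 0) ≤ size q :=
      single_le_sum (f := fun q' => if k q' = k q then (1 : ℝ) else 0)
        (fun q' _ => by positivity) (mem_univ q)
    rw [if_pos rfl] at this
    linarith
  have hsq_ge : ∀ q, c q = 1 → size q ≤ sq q := fun q hq => by
    have h1 : (∑ q', if k q' = k q then M q' else 0) = size q := by
      rw [hM]
      refine sum_congr rfl fun q' _ => ?_
      split_ifs with h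
      · rw [hk q' q h, hq]
      · rfl
    have h2 : ∀ q', (if k q' = k q then M q' else 0) ≤
        (1 / 2) * (if k q' = k q then M q' ^ 2 else 0) +
          (1 / 2) * (if k q' = k q then 1 else 0) := fun q' => by
      split_ifs
      · nlinarith [sq_nonneg (M q' - 1)]
      · norm_num
    have h3 := sum_le_sum fun q' (_ : q' ∈ univ) => h2 q'
    rw [h1, sum_add_distrib, ← mul_sum, ← mul_sum] at h3
    change size q ≤ 1 / 2 * sq q + 1 / 2 * size q at h3
    linarith
  refine ⟨fun q => c q * (size q / sq q) * M q ^ 2, fun q => ?_, fun q => ?_, fun t => ?_⟩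
  · rcases hc q with h | h
    · simp [h]
    · have := hsq_ge q h
      have := hsize_pos q
      dsimp only
      rw [h]
      have : 0 < sq q := by linarith
      positivity
  · rcases hc q with h | h
    · simp only [h, zero_mul]; positivity
    · have h1 := hsq_ge q h
      have h2 := hsize_pos q
      dsimp only
      rw [h, one_mul]
      exact mul_le_of_le_one_left (sq_nonneg _) ((div_le_one (by linarith)).2 h1)
  · have hswap : ∀ q, c q * (size q / sq q) * M q ^ 2 * t (k q) =
        ∑ q', if k q' = k q then c q' / sq q' * t (k q') * M q ^ 2 else 0 := fun q => by
      have : ∀ q', (if k q' = k q then c q' / sq q' * t (k q') * M q ^ 2 else 0) =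
          (c q / sq q * t (k q) * M q ^ 2) * if k q' = k q then 1 else 0 := fun q' => by
        split_ifs with h
        · simp only [hsq, h, hk q' q h, mul_one]
        · rw [mul_zero]
      simp only [this, ← mul_sum]
      change _ = _ * size q
      ring
    simp only [hswap]
    rw [sum_comm]
    refine sum_congr rfl fun q _ => ?_
    have : (∑ q', if k q = k q' then c q / sq q * t (k q) * M q' ^ 2 else 0) =
        c q / sq q * t (k q) * sq q := by
      simp only [hsq, mul_sum]
      refine sum_congr rfl fun q' _ => ?_
      simp only [eq_comm (a := k q)]
      split_ifs <;> simp
    rw [this]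
    rcases hc q with h | h
    · simp [h]
    · have h1 := hsq_ge q h
      have h2 := hsize_pos q
      have : sq q ≠ 0 := by linarith
      field_simp

namespace CayleyGraph

variable (G : CayleyGraph ℓ)

theorem quadCoeff_eq_of_monoKey_eq (lam : ℝ) {q q' : Fin 4 → Vertex ℓ}
    (h : monoKey q = monoKey q') : G.quadCoeff lam q = G.quadCoeff lam q' := by
  classical
  have hsum : ∀ q : Fin 4 → Vertex ℓ,
      ∑ i, q i = Finsupp.linearCombination ℕ (id : Vertex ℓ → Vertex ℓ) (monoKey q) := by
    intro q; simp [monoKey, map_sum]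
  have hall : ∀ q : Fin 4 → Vertex ℓ, (∀ i, lam ≤ G.symbol (q i)) ↔
      ∀ a, monoKey q a ≠ 0 → lam ≤ G.symbol a := by
    intro q
    have hk : ∀ a, monoKey q a ≠ 0 ↔ ∃ i, q i = a := fun a => by
      simp [monoKey, Finsupp.single_apply]
    simp only [hk]
    exact ⟨fun h a ⟨i, hi⟩ => hi ▸ h i, fun h i => h _ ⟨i, rfl⟩⟩
  simp only [quadCoeff, hsum, hall, h]

/-- The polynomial `P_lam` has a representation by a matrix with nonnegative entries whose row
and column sums are bounded in terms of the spectral norm. The second conclusion says that the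
matrix and `P_lam` have the same sums over the rearrangements of each quadruple. -/
theorem exists_nonneg_matrix {lam : ℝ} (hlam : lam ≤ 1) :
    ∃ N : (Fin 4 → Vertex ℓ) → ℝ, (∀ q, 0 ≤ N q) ∧
      (∀ t : (Vertex ℓ →₀ ℕ) → ℝ,
        ∑ q, N q * t (monoKey q) = ∑ q, G.quadCoeff lam q * t (monoKey q)) ∧
      (∀ a : Vertex ℓ × Vertex ℓ → ℝ,
        ∑ q, N q * a (q 0, q 1) ^ 2 ≤ (2 * G.specK lam) ^ 2 * ∑ p, a p ^ 2) ∧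
      (∀ a : Vertex ℓ × Vertex ℓ → ℝ,
        ∑ q, N q * a (q 2, q 3) ^ 2 ≤ (2 * G.specK lam) ^ 2 * ∑ p, a p ^ 2) := by
  obtain ⟨Q, hQ, hbound⟩ := G.exists_quadraticForm_le hlam
  have hK := G.one_le_specK hlam
  set c := 2 * G.specK lam
  have hc : 0 < c := by change 0 < 2 * _; linarith
  set B := QuadraticMap.associated (R := ℝ) Q with hB
  have hrow : ∀ p, ∑ r, B (chiTensor p) (chiTensor r) ^ 2 ≤ c ^ 2 :=
    sum_associated_sq_le hc hbound
  have hsymm : ∀ x y, B x y = B y x := fun x y =>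
    QuadraticMap.associated_isSymm ℝ Q x y
  set M : (Fin 4 → Vertex ℓ) → ℝ := fun q =>
    B (chiTensor (q 0, q 1)) (chiTensor (q 2, q 3)) with hM
  have hrep : ∀ u : Vertex ℓ → ℝ, ∑ q, M q * ∏ i, u (q i) =
      ∑ q, G.quadCoeff lam q * ∏ i, u (q i) := fun u => by
    have hfu : ∀ a, fhat (fun x => ∑ b, u b * chi b x) a = u a := fhat_sum_chi u
    have h1 := G.eval_topPoly_eq_sum lam (fun x => ∑ b, u b * chi b x)
    simp only [hfu] at h1
    rw [← h1, ← hQ, ← QuadraticMap.associated_eq_self_apply ℝ Q, tensorSq_eq_sum]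
    simp only [hfu]
    change _ = B _ _
    simp only [map_sum, map_smul, LinearMap.sum_apply, LinearMap.smul_apply, smul_eq_mul, mul_sum]
    rw [← sum_quad fun p r => u p.1 * u p.2 * (u r.1 * u r.2 * B (chiTensor r) (chiTensor p))]
    refine sum_congr rfl fun q _ => ?_
    rw [hsymm (chiTensor (q 2, q 3))]
    simp only [hM, Fin.prod_univ_four]
    ring
  obtain ⟨N, hN0, hNM, hN⟩ := exists_nonneg_weights monoKey M (G.quadCoeff lam)
    (fun q => by unfold quadCoeff; split_ifs <;> simp)
    (fun q q' h => G.quadCoeff_eq_of_monoKey_eq lam h) (sum_fiber_eq M _ hrep)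
  refine ⟨N, hN0, hN, fun a => ?_, fun a => ?_⟩
  · calc ∑ q, N q * a (q 0, q 1) ^ 2 ≤ ∑ q, M q ^ 2 * a (q 0, q 1) ^ 2 :=
          sum_le_sum fun q _ => mul_le_mul_of_nonneg_right (hNM q) (sq_nonneg _)
      _ = ∑ p, ∑ r, B (chiTensor p) (chiTensor r) ^ 2 * a p ^ 2 :=
          sum_quad fun p r => B (chiTensor p) (chiTensor r) ^ 2 * a p ^ 2
      _ ≤ ∑ p, c ^ 2 * a p ^ 2 := sum_le_sum fun p _ => by
          rw [← sum_mul]; exact mul_le_mul_of_nonneg_right (hrow p) (sq_nonneg _)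
      _ = _ := by rw [mul_sum]
  · calc ∑ q, N q * a (q 2, q 3) ^ 2 ≤ ∑ q, M q ^ 2 * a (q 2, q 3) ^ 2 :=
          sum_le_sum fun q _ => mul_le_mul_of_nonneg_right (hNM q) (sq_nonneg _)
      _ = ∑ p, ∑ r, B (chiTensor p) (chiTensor r) ^ 2 * a r ^ 2 :=
          sum_quad fun p r => B (chiTensor p) (chiTensor r) ^ 2 * a r ^ 2
      _ = ∑ r, ∑ p, B (chiTensor r) (chiTensor p) ^ 2 * a r ^ 2 := by
          rw [sum_comm]
          exact sum_congr rfl fun r _ => sum_congr rfl fun p _ => by rw [hsymm]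
      _ ≤ ∑ r, c ^ 2 * a r ^ 2 := sum_le_sum fun r _ => by
          rw [← sum_mul]; exact mul_le_mul_of_nonneg_right (hrow r) (sq_nonneg _)
      _ = _ := by rw [mul_sum]

end CayleyGraph

/-! ### Entropy and near independence of exchangeable letters -/

section Words

variable {V : Type*} [Fintype V]

/-- The sum of `F` over all words of length `s`. -/
def wordSum (F : List V → ℝ) (s : ℕ) : ℝ := ∑ w : Fin s → V, F (List.ofFn w)

theorem wordSum_zero (F : List V → ℝ) : wordSum F 0 = F [] := by simp [wordSum]

theorem wordSum_succ (F : List V → ℝ) (s : ℕ) :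
    wordSum F (s + 1) = wordSum (fun w => ∑ a, F (a :: w)) s := by
  unfold wordSum
  rw [← Fintype.sum_prod_type_right']
  refine (Fintype.sum_equiv (Fin.consEquiv fun _ => V) _ _ fun x => ?_).symm
  simp [Fin.consEquiv, List.ofFn_succ]

theorem wordSum_mono {F F' : List V → ℝ} {s : ℕ} (h : ∀ w, w.length = s → F w ≤ F' w) :
    wordSum F s ≤ wordSum F' s :=
  sum_le_sum fun w _ => h _ (by simp)

theorem wordSum_congr {F F' : List V → ℝ} {s : ℕ} (h : ∀ w, w.length = s → F w = F' w) :
    wordSum F s = wordSum F' s :=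
  sum_congr rfl fun w _ => h _ (by simp)

theorem wordSum_add (F F' : List V → ℝ) (s : ℕ) :
    wordSum (fun w => F w + F' w) s = wordSum F s + wordSum F' s := sum_add_distrib

theorem wordSum_const_mul (c : ℝ) (F : List V → ℝ) (s : ℕ) :
    wordSum (fun w => c * F w) s = c * wordSum F s := (mul_sum _ _ _).symm

/-- A function on words that is the sum of its values over all one-letter extensions has the same
total over the words of each length. -/
theorem wordSum_eq_of_marginal {F : List V → ℝ} {t : ℕ}
    (h : ∀ w, w.length < t → ∑ a, F (a :: w) = F w) : ∀ s ≤ t, wordSum F s = F []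
  | 0, _ => wordSum_zero F
  | s + 1, hs => by
    rw [wordSum_succ, wordSum_congr fun w hw => h w (by omega)]
    exact wordSum_eq_of_marginal h s (by omega)

open Real in
/-- The conditional mutual information of two letters bounds their squared Hellinger distance from
independence. Here `p₂` is an unnormalized joint distribution of total mass `p₀`, and `p₁` is its
marginal. -/
theorem hellinger_le_mutualInfo {p₀ : ℝ} {p₁ : V → ℝ} {p₂ : V → V → ℝ}
    (h₂ : ∀ a b, 0 ≤ p₂ a b) (hsymm : ∀ a b, p₂ a b = p₂ b a)
    (hm₁ : ∀ b, ∑ a, p₂ a b = p₁ b) (hm₀ : ∑ a, p₁ a = p₀) :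
    ∑ a, ∑ b, (√(p₂ a b) - √(p₁ a) * √(p₁ b) / √p₀) ^ 2 ≤
      2 * ∑ a, negMulLog (p₁ a) - negMulLog p₀ - ∑ b, ∑ a, negMulLog (p₂ a b) := by
  have h₁ : ∀ a, 0 ≤ p₁ a := fun a => hm₁ a ▸ sum_nonneg fun b _ => h₂ b a
  have h₀ : 0 ≤ p₀ := hm₀ ▸ sum_nonneg fun a _ => h₁ a
  have h21 : ∀ a b, p₂ a b ≤ p₁ b := fun a b => by
    rw [← hm₁ b]
    exact single_le_sum (f := fun a => p₂ a b) (fun a _ => h₂ a b) (mem_univ a)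
  have h10 : ∀ a, p₁ a ≤ p₀ := fun a => by
    rw [← hm₀]
    exact single_le_sum (f := p₁) (fun a _ => h₁ a) (mem_univ a)
  have hm₁' : ∀ a, ∑ b, p₂ a b = p₁ a := fun a => by
    rw [← hm₁ a]; exact sum_congr rfl fun b _ => hsymm a b
  have key : ∀ a b, (√(p₂ a b) - √(p₁ a) * √(p₁ b) / √p₀) ^ 2 ≤
      (p₂ a b * log (p₂ a b) + p₂ a b * log p₀ - p₂ a b * log (p₁ a) - p₂ a b * log (p₁ b)) +
        (p₁ a * p₁ b / p₀ - p₂ a b) := by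
    intro a b
    have hsq : (√(p₁ a) * √(p₁ b) / √p₀) ^ 2 = p₁ a * p₁ b / p₀ := by
      rw [div_pow, mul_pow, sq_sqrt (h₁ a), sq_sqrt (h₁ b), sq_sqrt h₀]
    rcases (h₂ a b).eq_or_lt with h | h
    · rw [← h]
      simp [hsq]
    · have hb : 0 < p₁ b := h.trans_le (h21 a b)
      have ha : 0 < p₁ a := h.trans_le (hsymm a b ▸ h21 b a)
      have h0 : 0 < p₀ := hb.trans_le (h10 b)
      set x := √(p₂ a b) with hx
      set y := √(p₁ a) * √(p₁ b) / √p₀ with hy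
      have hxpos : 0 < x := sqrt_pos.2 h
      have hypos : 0 < y := by positivity
      have hlog : log (y / x) =
          (log (p₁ a) + log (p₁ b) - log p₀ - log (p₂ a b)) / 2 := by
        rw [log_div hypos.ne' hxpos.ne', hy, log_div (by positivity) (by positivity),
          log_mul (by positivity) (by positivity), hx, log_sqrt ha.le, log_sqrt hb.le,
          log_sqrt h0.le, log_sqrt h.le]
        ring
      have h1 := log_le_sub_one_of_pos (div_pos hypos hxpos)
      rw [hlog] at h1
      have h2 : p₂ a b = x ^ 2 := (sq_sqrt h.le).symm
      have h3 : x ^ 2 * ((log (p₁ a) + log (p₁ b) - log p₀ - log (p₂ a b)) / 2) ≤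
          x * y - x ^ 2 := by
        calc _ ≤ x ^ 2 * (y / x - 1) := mul_le_mul_of_nonneg_left h1 (sq_nonneg _)
          _ = x * y - x ^ 2 := by field_simp
      rw [← h2] at h3
      rw [sub_sq, hsq, ← h2]
      nlinarith
  refine (sum_le_sum fun a _ => sum_le_sum fun b _ => key a b).trans (le_of_eq ?_)
  have hprod : ∑ a, ∑ b, p₁ a * p₁ b / p₀ = p₀ := by
    simp only [← sum_div, ← mul_sum, ← sum_mul, hm₀]
    rcases eq_or_ne p₀ 0 with h | h
    · simp [h]
    · field_simp
  have e1 : ∑ a, ∑ b, p₂ a b = p₀ := by simp only [hm₁', hm₀]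
  have e2 : ∑ a, ∑ b, p₂ a b * log p₀ = p₀ * log p₀ := by
    simp only [← sum_mul, hm₁', hm₀]
  have e3 : ∑ a, ∑ b, p₂ a b * log (p₁ a) = ∑ a, p₁ a * log (p₁ a) := by
    simp only [← sum_mul, hm₁']
  have e4 : ∑ a, ∑ b, p₂ a b * log (p₁ b) = ∑ a, p₁ a * log (p₁ a) := by
    rw [sum_comm]
    simp only [← sum_mul, hm₁]
  have e5 : ∑ b, ∑ a, negMulLog (p₂ a b) = -∑ a, ∑ b, p₂ a b * log (p₂ a b) := by
    rw [sum_comm]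
    simp [negMulLog]
  simp only [sum_add_distrib, sum_sub_distrib, hprod, e1, e2, e3, e4, e5]
  simp only [negMulLog, neg_mul, sum_neg_distrib]
  ring

open Real in
theorem negMulLog_le_sum {p₀ : ℝ} {p₁ : V → ℝ} (h₁ : ∀ a, 0 ≤ p₁ a) (hm : ∑ a, p₁ a = p₀) :
    negMulLog p₀ ≤ ∑ a, negMulLog (p₁ a) := by
  have : negMulLog p₀ = ∑ a, -(p₁ a * log p₀) := by
    rw [sum_neg_distrib, ← sum_mul, hm, negMulLog, neg_mul]
  rw [this]
  refine sum_le_sum fun a _ => ?_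
  rw [negMulLog, neg_mul, neg_le_neg_iff]
  rcases (h₁ a).eq_or_lt with h | h
  · simp [← h]
  · refine mul_le_mul_of_nonneg_left (log_le_log h ?_) (h₁ a)
    rw [← hm]
    exact single_le_sum (f := p₁) (fun a _ => h₁ a) (mem_univ a)

open Real in
theorem sum_negMulLog_le_log_card [Nonempty V] {p₁ : V → ℝ} (h₁ : ∀ a, 0 ≤ p₁ a)
    (hm : ∑ a, p₁ a = 1) : ∑ a, negMulLog (p₁ a) ≤ log (Fintype.card V) := by
  have hn : (0 : ℝ) < Fintype.card V := by exact_mod_cast Fintype.card_pos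
  have key : ∀ a, negMulLog (p₁ a) ≤
      p₁ a * log (Fintype.card V) + ((Fintype.card V : ℝ)⁻¹ - p₁ a) := by
    intro a
    rcases (h₁ a).eq_or_lt with h | h
    · simp [← h]
    · have h1 := log_le_sub_one_of_pos (inv_pos.2 (mul_pos hn h))
      rw [log_inv, log_mul hn.ne' h.ne'] at h1
      have h2 := mul_le_mul_of_nonneg_left h1 h.le
      have h3 : p₁ a * (((Fintype.card V : ℝ) * p₁ a)⁻¹ - 1) =
          (Fintype.card V : ℝ)⁻¹ - p₁ a := by field_simp
      rw [h3] at h2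
      rw [negMulLog]
      linarith
  refine (sum_le_sum fun a _ => key a).trans (le_of_eq ?_)
  rw [sum_add_distrib, ← sum_mul, sum_sub_distrib, hm, sum_const, card_univ, nsmul_eq_mul,
    mul_inv_cancel₀ hn.ne']
  ring

/-- The squared Hellinger distance from independence of the two letters following the word `w`,
for the unnormalized weights `p`; division by zero makes the product term vanish when `p w = 0`. -/
def hellinger (p : List V → ℝ) (w : List V) : ℝ :=
  ∑ a, ∑ b, (√(p (a :: b :: w)) - √(p (a :: w)) * √(p (b :: w)) / √(p w)) ^ 2

open Real in
/-- Letters become nearly independent after conditioning on a prefix of suitable length: the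
mutual informations along an exchangeable sequence telescope to at most the entropy of one
letter. -/
theorem exists_wordSum_hellinger_le [Nonempty V] {p : List V → ℝ} {t : ℕ} (ht : 0 < t)
    (hp : ∀ w, 0 ≤ p w) (hone : p [] = 1) (hm : ∀ w, w.length ≤ t → ∑ a, p (a :: w) = p w)
    (hsymm : ∀ a b w, p (a :: b :: w) = p (b :: a :: w)) :
    ∃ s < t, wordSum (hellinger p) s ≤ log (Fintype.card V) / t := by
  set H : ℕ → ℝ := wordSum fun w => negMulLog (p w) with hH
  have hstep : ∀ s < t, wordSum (hellinger p) s ≤ (H (s + 1) - H s) - (H (s + 2) - H (s + 1)) := by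
    intro s hs
    have h1 : wordSum (hellinger p) s ≤ wordSum (fun w => 2 * ∑ a, negMulLog (p (a :: w)) +
        ((-1) * negMulLog (p w) + (-1) * ∑ b, ∑ a, negMulLog (p (a :: b :: w)))) s := by
      refine wordSum_mono fun w hw => ?_
      refine (hellinger_le_mutualInfo (p₀ := p w) (p₁ := fun a => p (a :: w))
        (p₂ := fun a b => p (a :: b :: w)) (fun _ _ => hp _) (fun a b => hsymm a b w)
        (fun b => hm _ ?_) (hm _ ?_)).trans (le_of_eq (by ring))
      · rw [List.length_cons]; omega
      · omega
    rw [wordSum_add, wordSum_add, wordSum_const_mul, wordSum_const_mul, wordSum_const_mul] at h1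
    have e1 : H (s + 1) = wordSum (fun w => ∑ a, negMulLog (p (a :: w))) s := wordSum_succ _ _
    have e2 : H (s + 2) = wordSum (fun w => ∑ b, ∑ a, negMulLog (p (a :: b :: w))) s := by
      rw [hH, wordSum_succ, wordSum_succ]
    rw [← e1, ← e2] at h1
    change _ ≤ 2 * H (s + 1) + (-1 * H s + -1 * H (s + 2)) at h1
    linarith
  by_contra! hcon
  have hsum : ∑ s ∈ range t, wordSum (hellinger p) s ≤ log (Fintype.card V) := by
    have h1 := sum_le_sum fun s (hs : s ∈ range t) => hstep s (mem_range.1 hs)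
    rw [sum_range_sub' (fun s => H (s + 1) - H s)] at h1
    have h2 : H t ≤ H (t + 1) := by
      rw [hH, wordSum_succ]
      exact wordSum_mono fun w hw => negMulLog_le_sum (fun a => hp _) (hm w hw.le)
    have h3 : H 0 = 0 := by simp [hH, wordSum_zero, hone]
    have h4 : H (0 + 1) ≤ log (Fintype.card V) := by
      rw [hH, wordSum_succ, wordSum_zero]
      refine sum_negMulLog_le_log_card (fun a => hp _) ?_
      rw [hm [] (by simp), hone]
    linarith
  have ht' : (0 : ℝ) < t := by exact_mod_cast ht
  have hlt := sum_lt_sum_of_nonempty (nonempty_range_iff.2 ht.ne')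
    fun s hs => hcon s (mem_range.1 hs)
  rw [sum_const, card_range, nsmul_eq_mul, mul_div_cancel₀ _ ht'.ne'] at hlt
  linarith

end Words

/-! ### Rounding pseudo-expectations -/

namespace PseudoExpectation

variable {ι : Type*} {d : ℕ} (E : PseudoExpectation ι d)

theorem sq_toLin_mul_le {p q : MvPolynomial ι ℝ} (hp : 2 * p.totalDegree ≤ d)
    (hq : 2 * q.totalDegree ≤ d) :
    E.toLin (p * q) ^ 2 ≤ E.toLin (p ^ 2) * E.toLin (q ^ 2) := by
  have h : ∀ x : ℝ, 0 ≤ E.toLin (q ^ 2) * (x * x) + 2 * E.toLin (p * q) * x + E.toLin (p ^ 2) := by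
    intro x
    have hdeg : 2 * (p + x • q).totalDegree ≤ d := by
      have h1 := MvPolynomial.totalDegree_add p (x • q)
      have h2 := MvPolynomial.totalDegree_smul_le x q
      omega
    have h1 := E.map_sq_nonneg _ hdeg
    have h2 : (p + x • q) ^ 2 = p ^ 2 + (2 * x) • (p * q) + (x * x) • q ^ 2 := by
      simp only [MvPolynomial.smul_eq_C_mul, map_mul, map_ofNat]; ring
    rw [h2, map_add, map_add, map_smul, map_smul, smul_eq_mul, smul_eq_mul] at h1
    linarith
  have := discrim_le_zero h
  rw [discrim] at this
  linarith

theorem toLin_mul_eq_zero {r p : MvPolynomial ι ℝ} (hr : E.Consistent r)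
    (hrd : 2 * r.totalDegree ≤ d) (hp : 2 * p.totalDegree ≤ d) : E.toLin (p * r) = 0 := by
  have h := E.sq_toLin_mul_le hp hrd
  rw [show E.toLin (r ^ 2) = 0 from hr, mul_zero] at h
  exact pow_eq_zero_iff two_ne_zero |>.1 (le_antisymm h (sq_nonneg _))

end PseudoExpectation

/-- The Fourier coefficient `f̂(a)` as a linear form in the indeterminates `f(x)`. -/
def fhatPoly (a : Vertex ℓ) : MvPolynomial (Vertex ℓ) ℝ :=
  ∑ x, MvPolynomial.C ((Fintype.card (Vertex ℓ) : ℝ)⁻¹ * chi a x) * MvPolynomial.X x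

theorem eval_fhatPoly (f : Vertex ℓ → ℝ) (a : Vertex ℓ) :
    MvPolynomial.eval f (fhatPoly a) = fhat f a := by
  simp [fhatPoly, fhat, mean, mul_sum, mul_assoc]

theorem totalDegree_fhatPoly_le (a : Vertex ℓ) : (fhatPoly a).totalDegree ≤ 1 := by
  refine MvPolynomial.totalDegree_finsetSum_le fun x _ => ?_
  refine (MvPolynomial.totalDegree_mul _ _).trans ?_
  rw [MvPolynomial.totalDegree_C, MvPolynomial.totalDegree_X]

theorem normSqPoly_eq_sum : normSqPoly (Vertex ℓ) = ∑ a, fhatPoly a ^ 2 := by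
  refine MvPolynomial.funext fun f => ?_
  have := mean_sq_eq_sum_fhat f
  simpa [normSqPoly, eval_fhatPoly, mean] using this

theorem totalDegree_normSqPoly_sub_one_le : (normSqPoly (Vertex ℓ) - 1).totalDegree ≤ 2 := by
  refine (MvPolynomial.totalDegree_sub _ _).trans (max_le ?_ (by simp))
  rw [normSqPoly_eq_sum]
  refine MvPolynomial.totalDegree_finsetSum_le fun a _ => ?_
  have := MvPolynomial.totalDegree_pow (fhatPoly a) 2
  have := totalDegree_fhatPoly_le a
  omega

namespace CayleyGraph

variable (G : CayleyGraph ℓ)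

theorem topPoly_eq_sum (lam : ℝ) :
    G.topPoly lam = ∑ q : Fin 4 → Vertex ℓ, G.quadCoeff lam q • ∏ i, fhatPoly (q i) := by
  refine MvPolynomial.funext fun f => ?_
  rw [eval_topPoly_eq_sum]
  simp [MvPolynomial.smul_eval, eval_fhatPoly]

theorem totalDegree_topPoly_le (lam : ℝ) : (G.topPoly lam).totalDegree ≤ 4 := by
  rw [topPoly_eq_sum]
  refine MvPolynomial.totalDegree_finsetSum_le fun q _ => ?_
  refine (MvPolynomial.totalDegree_smul_le _ _).trans ?_
  refine (MvPolynomial.totalDegree_finsetProd _ _).trans ?_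
  refine (sum_le_sum fun i _ => totalDegree_fhatPoly_le (q i)).trans ?_
  simp

end CayleyGraph

/-- The product of the Fourier coefficients at the letters of a word. -/
def wordPoly (w : List (Vertex ℓ)) : MvPolynomial (Vertex ℓ) ℝ := (w.map fhatPoly).prod

theorem wordPoly_cons (a : Vertex ℓ) (w : List (Vertex ℓ)) :
    wordPoly (a :: w) = fhatPoly a * wordPoly w := by simp [wordPoly]

theorem totalDegree_wordPoly_le (w : List (Vertex ℓ)) : (wordPoly w).totalDegree ≤ w.length := by
  induction w with
  | nil => simp [wordPoly]
  | cons a w ih =>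
    rw [wordPoly_cons, List.length_cons]
    have := MvPolynomial.totalDegree_mul (fhatPoly a) (wordPoly w)
    have := totalDegree_fhatPoly_le a
    omega

namespace PseudoExpectation

variable {d : ℕ} (E : PseudoExpectation (Vertex ℓ) d)

/-- The pseudo-distribution of words whose letters are drawn with probability `f̂(a)²`. -/
def wordWeight (w : List (Vertex ℓ)) : ℝ := E.toLin (wordPoly w ^ 2)

theorem sum_toLin_cons (hE : E.Consistent (normSqPoly (Vertex ℓ) - 1)) (hd : 4 ≤ d)
    (w : List (Vertex ℓ)) (P : MvPolynomial (Vertex ℓ) ℝ)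
    (hw : 2 * (2 * w.length + P.totalDegree) ≤ d) :
    ∑ a, E.toLin (wordPoly (a :: w) ^ 2 * P) = E.toLin (wordPoly w ^ 2 * P) := by
  have hdeg : 2 * (wordPoly w ^ 2 * P).totalDegree ≤ d := by
    have h1 := MvPolynomial.totalDegree_mul (wordPoly w ^ 2) P
    have h2 := MvPolynomial.totalDegree_pow (wordPoly w) 2
    have h3 := totalDegree_wordPoly_le w
    omega
  have h := E.toLin_mul_eq_zero hE
    (by have := totalDegree_normSqPoly_sub_one_le (ℓ := ℓ); omega) hdeg
  rw [mul_sub, mul_one, map_sub, sub_eq_zero] at h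
  rw [← h, normSqPoly_eq_sum, mul_sum, map_sum]
  refine sum_congr rfl fun a _ => ?_
  rw [wordPoly_cons, show (fhatPoly a * wordPoly w) ^ 2 * P =
    wordPoly w ^ 2 * P * fhatPoly a ^ 2 by ring]

theorem sum_wordWeight_cons (hE : E.Consistent (normSqPoly (Vertex ℓ) - 1)) (hd : 4 ≤ d)
    (w : List (Vertex ℓ)) (hw : 4 * w.length ≤ d) :
    ∑ a, E.wordWeight (a :: w) = E.wordWeight w := by
  simpa [wordWeight] using E.sum_toLin_cons hE hd w 1 (by simp; omega)

theorem wordWeight_nonneg (w : List (Vertex ℓ)) (hw : 2 * w.length ≤ d) :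
    0 ≤ E.wordWeight w :=
  E.map_sq_nonneg _ (by have := totalDegree_wordPoly_le w; omega)

open Real in
theorem abs_toLin_quad_le (w : List (Vertex ℓ)) (hw : 2 * w.length + 4 ≤ d)
    (q : Fin 4 → Vertex ℓ) :
    |E.toLin (wordPoly w ^ 2 * ∏ i, fhatPoly (q i))| ≤
      √(E.wordWeight (q 0 :: q 1 :: w)) * √(E.wordWeight (q 2 :: q 3 :: w)) := by
  have hdeg : ∀ a b, 2 * (wordPoly (a :: b :: w)).totalDegree ≤ d := fun a b => by
    have := totalDegree_wordPoly_le (a :: b :: w)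
    simp only [List.length_cons] at this
    omega
  have hcs := E.sq_toLin_mul_le (hdeg (q 0) (q 1)) (hdeg (q 2) (q 3))
  have h1 : wordPoly w ^ 2 * ∏ i, fhatPoly (q i) =
      wordPoly (q 0 :: q 1 :: w) * wordPoly (q 2 :: q 3 :: w) := by
    simp only [wordPoly_cons, Fin.prod_univ_four]
    ring
  unfold wordWeight
  rw [h1, ← sqrt_mul (E.map_sq_nonneg _ (hdeg _ _)), ← sqrt_sq_eq_abs]
  exact sqrt_le_sqrt hcs

end PseudoExpectation

/-- A perturbation bound for the quadratic form of a nonnegative matrix whose row and column sums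
are at most `c`. -/
theorem sum_mul_add_mul_add_le {V : Type*} [Fintype V] {N : (Fin 4 → V) → ℝ} {c κ : ℝ}
    (hκ : 0 < κ) (hN : ∀ q, 0 ≤ N q)
    (hrow : ∀ a : V × V → ℝ, ∑ q, N q * a (q 0, q 1) ^ 2 ≤ c * ∑ p, a p ^ 2)
    (hcol : ∀ a : V × V → ℝ, ∑ q, N q * a (q 2, q 3) ^ 2 ≤ c * ∑ p, a p ^ 2)
    (X Y : V × V → ℝ) :
    ∑ q, N q * ((X (q 0, q 1) + Y (q 0, q 1)) * (X (q 2, q 3) + Y (q 2, q 3))) ≤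
      ∑ q, N q * (X (q 0, q 1) * X (q 2, q 3)) +
        (c * κ * ∑ r, X r ^ 2 + c * (1 / κ + 1) * ∑ r, Y r ^ 2) := by
  have hpoint : ∀ q, N q * ((X (q 0, q 1) + Y (q 0, q 1)) * (X (q 2, q 3) + Y (q 2, q 3))) ≤
      N q * (X (q 0, q 1) * X (q 2, q 3)) +
      ((κ / 2) * (N q * X (q 0, q 1) ^ 2) + (κ / 2) * (N q * X (q 2, q 3) ^ 2) +
      ((1 / (2 * κ) + 1 / 2) * (N q * Y (q 0, q 1) ^ 2) +
        (1 / (2 * κ) + 1 / 2) * (N q * Y (q 2, q 3) ^ 2))) := by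
    intro q
    have amgm : ∀ x y : ℝ, x * y ≤ κ / 2 * x ^ 2 + 1 / (2 * κ) * y ^ 2 := fun x y => by
      have : κ / 2 * x ^ 2 + 1 / (2 * κ) * y ^ 2 - x * y = (κ * x - y) ^ 2 / (2 * κ) := by
        field_simp; ring
      have : 0 ≤ (κ * x - y) ^ 2 / (2 * κ) := by positivity
      linarith
    have h2 := amgm (X (q 0, q 1)) (Y (q 2, q 3))
    have h3 := amgm (X (q 2, q 3)) (Y (q 0, q 1))
    have h4 := sq_nonneg (Y (q 0, q 1) - Y (q 2, q 3))
    have h5 : (X (q 0, q 1) + Y (q 0, q 1)) * (X (q 2, q 3) + Y (q 2, q 3)) ≤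
        X (q 0, q 1) * X (q 2, q 3) + (κ / 2 * X (q 0, q 1) ^ 2 + κ / 2 * X (q 2, q 3) ^ 2 +
          ((1 / (2 * κ) + 1 / 2) * Y (q 0, q 1) ^ 2 +
            (1 / (2 * κ) + 1 / 2) * Y (q 2, q 3) ^ 2)) := by linarith
    refine (mul_le_mul_of_nonneg_left h5 (hN q)).trans (le_of_eq ?_)
    ring
  have hfin := sum_le_sum fun q (_ : q ∈ univ) => hpoint q
  simp only [sum_add_distrib, ← mul_sum] at hfin
  refine hfin.trans (add_le_add_right ?_ _)
  have hκ2 : 0 ≤ κ / 2 := by positivity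
  have hκ3 : 0 ≤ 1 / (2 * κ) + 1 / 2 := by positivity
  have s1 := mul_le_mul_of_nonneg_left (hrow X) hκ2
  have s2 := mul_le_mul_of_nonneg_left (hcol X) hκ2
  have s3 := mul_le_mul_of_nonneg_left (hrow Y) hκ3
  have s4 := mul_le_mul_of_nonneg_left (hcol Y) hκ3
  refine (add_le_add (add_le_add s1 s2) (add_le_add s3 s4)).trans (le_of_eq ?_)
  field_simp
  ring

open Real in
/-- The rounding of a pseudo-distribution, conditioned on a word of weight `p₀`: for weights `p₁` of
total mass `p₀`, the product weights `√(p₁ a) √(p₁ b) / √p₀` evaluate `P_lam` at the unit vector with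
Fourier coefficients `√(p₁ a / p₀)`, up to the factor `p₀`. -/
theorem sum_quadCoeff_mul_le (G : CayleyGraph ℓ) {lam T p₀ : ℝ} {p₁ : Vertex ℓ → ℝ}
    (hT : ∀ f : Vertex ℓ → ℝ, mean (fun x => f x ^ 2) = 1 →
      MvPolynomial.eval f (G.topPoly lam) ≤ T)
    (h₀ : 0 ≤ p₀) (h₁ : ∀ a, 0 ≤ p₁ a) (hsum : ∑ a, p₁ a = p₀) :
    ∑ q : Fin 4 → Vertex ℓ, G.quadCoeff lam q * (p₀ * ∏ i, √(p₁ (q i)) / √p₀) ≤ T * p₀ := by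
  rcases h₀.eq_or_lt with h | h
  · simp [← h]
  set v : Vertex ℓ → ℝ := fun a => √(p₁ a) / √p₀ with hv
  have hfv : ∀ a, fhat (fun x => ∑ b, v b * chi b x) a = v a := fhat_sum_chi v
  have h2 := hT (fun x => ∑ b, v b * chi b x) (by
    rw [mean_sq_eq_sum_fhat]
    simp only [hfv]
    simp only [hv, div_pow, sq_sqrt (h₁ _), sq_sqrt h₀]
    rw [← sum_div, hsum, div_self h.ne'])
  rw [G.eval_topPoly_eq_sum] at h2
  simp only [hfv] at h2
  calc _ = (∑ q, G.quadCoeff lam q * ∏ i, v (q i)) * p₀ := by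
        rw [sum_mul]; exact sum_congr rfl fun q _ => by ring
    _ ≤ _ := mul_le_mul_of_nonneg_right h2 h₀

namespace PseudoExpectation

variable {d : ℕ} (E : PseudoExpectation (Vertex ℓ) d)

open Real in
/-- Conditioned on the word `w`, the value of `P_lam` is at most its maximum on the sphere, up to an
error measured by how far the next two letters are from independent. Here nonnegative coefficients
matter: pseudo-moments of degree four are bounded by the Cauchy–Schwarz inequality, separately for
each entry. -/
theorem toLin_wordPoly_sq_mul_topPoly_le (G : CayleyGraph ℓ) {lam T κ : ℝ} (hlam : lam ≤ 1)
    (hκ : 0 < κ)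
    (hT : ∀ f : Vertex ℓ → ℝ, mean (fun x => f x ^ 2) = 1 →
      MvPolynomial.eval f (G.topPoly lam) ≤ T)
    (hE : E.Consistent (normSqPoly (Vertex ℓ) - 1)) (w : List (Vertex ℓ))
    (hw : 4 * w.length + 8 ≤ d) :
    E.toLin (wordPoly w ^ 2 * G.topPoly lam) ≤
      (T + (2 * G.specK lam) ^ 2 * κ) * E.wordWeight w +
        (2 * G.specK lam) ^ 2 * (1 / κ + 1) * hellinger E.wordWeight w := by
  obtain ⟨N, hN0, hN, hrow, hcol⟩ := G.exists_nonneg_matrix hlam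
  have hpw : 0 ≤ E.wordWeight w := E.wordWeight_nonneg w (by omega)
  have hp1 : ∀ a, 0 ≤ E.wordWeight (a :: w) := fun a =>
    E.wordWeight_nonneg _ (by rw [List.length_cons]; omega)
  have hsum : ∑ a, E.wordWeight (a :: w) = E.wordWeight w :=
    E.sum_wordWeight_cons hE (by omega) w (by omega)
  have hquad := E.abs_toLin_quad_le w (by omega)
  -- the pseudo-moments as a function of the monomial
  set t : (Vertex ℓ →₀ ℕ) → ℝ := fun k =>
    |E.toLin (wordPoly w ^ 2 * k.prod fun a n => fhatPoly a ^ n)| with ht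
  have htq : ∀ q, t (monoKey q) = |E.toLin (wordPoly w ^ 2 * ∏ i, fhatPoly (q i))| := fun q => by
    rw [ht]; dsimp only; rw [prod_monoKey]
  have hstart : E.toLin (wordPoly w ^ 2 * G.topPoly lam) ≤ ∑ q, N q * t (monoKey q) := by
    rw [hN, G.topPoly_eq_sum, mul_sum, map_sum]
    refine sum_le_sum fun q _ => ?_
    rw [mul_smul_comm, map_smul, smul_eq_mul, htq]
    refine mul_le_mul_of_nonneg_left (le_abs_self _) ?_
    unfold CayleyGraph.quadCoeff; split_ifs <;> norm_num
  simp only [htq] at hstart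
  have hmain := sum_quadCoeff_mul_le G hT hpw hp1 hsum
  have hkey := hN fun k => E.wordWeight w * k.prod fun a n =>
    (√(E.wordWeight (a :: w)) / √(E.wordWeight w)) ^ n
  simp only [prod_monoKey (g := fun a => √(E.wordWeight (a :: w)) / √(E.wordWeight w))] at hkey
  rw [← hkey] at hmain
  clear hkey hN ht htq t
  simp only [hellinger]
  generalize E.wordWeight = p at *
  set X : Vertex ℓ × Vertex ℓ → ℝ := fun r =>
    √(p (r.1 :: w)) * √(p (r.2 :: w)) / √(p w) with hX
  set Y : Vertex ℓ × Vertex ℓ → ℝ := fun r =>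
    |√(p (r.1 :: r.2 :: w)) - √(p (r.1 :: w)) * √(p (r.2 :: w)) / √(p w)| with hY
  have hX0 : ∀ r, 0 ≤ X r := fun r =>
    div_nonneg (mul_nonneg (sqrt_nonneg _) (sqrt_nonneg _)) (sqrt_nonneg _)
  have hY0 : ∀ r, 0 ≤ Y r := fun r => abs_nonneg _
  have hXX : ∑ r, X r ^ 2 = p w := by
    simp only [hX, div_pow, mul_pow, sq_sqrt (hp1 _), sq_sqrt hpw]
    rw [← sum_div, Fintype.sum_prod_type]
    simp only [← mul_sum, ← sum_mul, hsum]
    rcases eq_or_ne (p w) 0 with h | h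
    · simp [h]
    · field_simp
  have hYY : ∑ r, Y r ^ 2 =
      ∑ a, ∑ b, (√(p (a :: b :: w)) - √(p (a :: w)) * √(p (b :: w)) / √(p w)) ^ 2 := by
    simp only [hY, sq_abs, Fintype.sum_prod_type]
  have h3 : ∀ a b, √(p (a :: b :: w)) ≤ X (a, b) + Y (a, b) := fun a b => by
    have := le_abs_self (√(p (a :: b :: w)) - √(p (a :: w)) * √(p (b :: w)) / √(p w))
    simp only [hX, hY]
    linarith
  have hXmain : ∑ q, N q * (X (q 0, q 1) * X (q 2, q 3)) ≤ T * p w := by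
    refine le_trans (le_of_eq (sum_congr rfl fun q _ => ?_)) hmain
    congr 1
    simp only [hX, Fin.prod_univ_four]
    rcases hpw.eq_or_lt with h | h
    · simp [← h]
    · have h2 := sq_sqrt hpw
      have h3 : √(p w) ≠ 0 := (sqrt_pos.2 h).ne'
      nth_rewrite 3 [← h2]
      field_simp
  refine hstart.trans ((sum_le_sum fun q _ => mul_le_mul_of_nonneg_left ((hquad q).trans
    (mul_le_mul (h3 _ _) (h3 _ _) (sqrt_nonneg _) (add_nonneg (hX0 _) (hY0 _)))) (hN0 q)).trans
      ((sum_mul_add_mul_add_le hκ hN0 hrow hcol X Y).trans ?_))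
  rw [hXX, hYY]
  linarith

/-- For a polynomial with nonnegative Fourier coefficients and spectral norm `K`, relaxations of
degree `O(K⁴ log n)` overestimate the maximum by at most a constant. -/
theorem toLin_topPoly_le (G : CayleyGraph ℓ) {lam T : ℝ} (hlam : lam ≤ 1)
    (hT : ∀ f : Vertex ℓ → ℝ, mean (fun x => f x ^ 2) = 1 →
      MvPolynomial.eval f (G.topPoly lam) ≤ T)
    (hE : E.Consistent (normSqPoly (Vertex ℓ) - 1)) {t : ℕ} (ht : 0 < t)
    (htd : 4 * t + 16 ≤ d)
    (htK : G.specK lam ^ 4 * Real.log (Fintype.card (Vertex ℓ)) ≤ t) :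
    E.toLin (G.topPoly lam) ≤ T + 12 := by
  have hK := G.one_le_specK hlam
  set K := G.specK lam with hKdef
  -- beyond the degree bound the weights are truncated, which does not affect short words
  set p : List (Vertex ℓ) → ℝ := fun w => max (E.wordWeight w) 0 with hp
  have hpw : ∀ w, w.length ≤ t + 4 → p w = E.wordWeight w := fun w hw =>
    max_eq_left (E.wordWeight_nonneg w (by omega))
  obtain ⟨s, hst, hs⟩ := exists_wordSum_hellinger_le (p := p) ht (fun w => le_max_right _ _)
    (by rw [hpw [] (by simp)]; simp [wordWeight, wordPoly, E.map_one])
    (fun w hw => by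
      rw [hpw w (by omega), ← E.sum_wordWeight_cons hE (by omega) w (by omega)]
      exact sum_congr rfl fun a _ => hpw _ (by rw [List.length_cons]; omega))
    (fun a b w => by simp only [hp, wordWeight, wordPoly_cons, mul_left_comm])
  have hs' : wordSum (hellinger E.wordWeight) s ≤ 1 / K ^ 4 := by
    have h1 : wordSum (hellinger p) s = wordSum (hellinger E.wordWeight) s :=
      wordSum_congr fun w hw => by
        simp only [hellinger]
        refine sum_congr rfl fun a _ => sum_congr rfl fun b _ => ?_
        rw [hpw w (by omega), hpw (a :: w) (by rw [List.length_cons]; omega),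
          hpw (b :: w) (by rw [List.length_cons]; omega),
          hpw (a :: b :: w) (by rw [List.length_cons, List.length_cons]; omega)]
    rw [← h1]
    refine hs.trans ?_
    have : (0 : ℝ) < t := by exact_mod_cast ht
    rw [div_le_div_iff₀ this (by positivity)]
    linarith
  have hP : wordSum (fun w => E.toLin (wordPoly w ^ 2 * G.topPoly lam)) s =
      E.toLin (G.topPoly lam) := by
    rw [wordSum_eq_of_marginal (t := t) (fun w hw => E.sum_toLin_cons hE (by omega) w _ (by
      have := G.totalDegree_topPoly_le lam; omega)) s hst.le]
    simp [wordPoly]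
  have hone : wordSum E.wordWeight s = 1 := by
    rw [wordSum_eq_of_marginal (t := t)
      (fun w hw => E.sum_wordWeight_cons hE (by omega) w (by omega)) s hst.le]
    simp [wordWeight, wordPoly, E.map_one]
  rw [← hP]
  have hκ : 0 < 1 / K ^ 2 := by positivity
  refine (wordSum_mono fun w hw =>
    E.toLin_wordPoly_sq_mul_topPoly_le G hlam hκ hT hE w (by omega)).trans ?_
  rw [wordSum_add, wordSum_const_mul, wordSum_const_mul, hone, ← hKdef]
  have h2 : (2 * K) ^ 2 * (1 / (1 / K ^ 2) + 1) * wordSum (hellinger E.wordWeight) s ≤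
      (2 * K) ^ 2 * (1 / (1 / K ^ 2) + 1) * (1 / K ^ 4) :=
    mul_le_mul_of_nonneg_left hs' (by positivity)
  have h3 : (2 * K) ^ 2 * (1 / (1 / K ^ 2) + 1) * (1 / K ^ 4) = 4 + 4 / K ^ 2 := by
    field_simp; ring
  have h4 : 4 / K ^ 2 ≤ 4 := div_le_self (by norm_num) (one_le_pow₀ hK)
  have h5 : (2 * K) ^ 2 * (1 / K ^ 2) = 4 := by field_simp; ring
  rw [h5]
  linarith

end PseudoExpectation

end CayleySSE

end

theorem theorem6p2 :
    ∃ (C A : ℝ) (k : ℕ) (μ₀ ε₀ : ℝ), 1 ≤ C ∧ 0 < A ∧ 0 < μ₀ ∧ 0 < ε₀ ∧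
      ∀ μ ε : ℝ, 0 < μ → μ ≤ μ₀ → 0 < ε → ε ≤ ε₀ →
        ∃ θ : ℝ, 0 < θ ∧
          ∀ (ℓ : ℕ), 1 ≤ ℓ → ∀ (G : CayleySSE.CayleyGraph ℓ) (d : ℕ),
            A * G.specK (1 - C * ε) ^ k * Real.log (2 ^ ℓ) ≤ (d : ℝ) →
              (G.YesCase μ ε →
                ((2 * θ : ℝ) : EReal) ≤ CayleySSE.sosValue d (G.topPoly (1 - C * ε))) ∧
              (G.NoCase (C * Real.sqrt μ) (1 - 1 / C) →
                CayleySSE.sosValue d (G.topPoly (1 - C * ε)) ≤ (θ : EReal)) := by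
  refine ⟨2, 50, 4, 1 / 4096, 1 / 100, by norm_num, by norm_num, by norm_num, by norm_num,
    fun μ ε hμ hμ' hε hε' => ⟨1 / (32 * μ), by positivity, fun ℓ hℓ G d hd => ⟨fun hyes => ?_,
      fun hno => ?_⟩⟩⟩
  · obtain ⟨f, hf, hval⟩ := G.exists_eval_topPoly_ge hμ hε hyes
    refine le_trans (EReal.coe_le_coe_iff.2 (le_trans (le_of_eq ?_) hval))
      (CayleySSE.eval_le_sosValue d _ f hf)
    field_simp
    norm_num
  · have hsqrt : 0 < √μ := Real.sqrt_pos.2 hμ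
    have hlam : 1 - 2 * ε ≤ 1 := by linarith
    have hK := G.one_le_specK hlam
    set K := G.specK (1 - 2 * ε)
    have hT : ∀ f : CayleySSE.Vertex ℓ → ℝ, CayleySSE.mean (fun x => f x ^ 2) = 1 →
        MvPolynomial.eval f (G.topPoly (1 - 2 * ε)) ≤ 1 / √μ := fun f hf => by
      have := G.eval_topPoly_le_of_noCase (δ := 2 * √μ) (τ := 2 * ε) (by positivity)
        (by positivity) (by linarith) (by norm_num at hno ⊢; exact hno) f hf
      refine this.trans (le_of_eq ?_)
      field_simp
    have hcard : (Fintype.card (CayleySSE.Vertex ℓ) : ℝ) = 2 ^ ℓ := by simp [ZMod.card]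
    have hlog : 1 / 2 ≤ Real.log (2 ^ ℓ) := by
      rw [Real.log_pow]
      have h1 : (1 : ℝ) ≤ ℓ := by exact_mod_cast hℓ
      have := Real.log_two_gt_d9
      nlinarith
    have hK4 : (1 : ℝ) ≤ K ^ 4 := one_le_pow₀ hK
    have hL : 1 / 2 ≤ K ^ 4 * Real.log (2 ^ ℓ) := by nlinarith
    set t := ⌈K ^ 4 * Real.log (2 ^ ℓ)⌉₊ with ht
    have ht0 : 0 < t := Nat.ceil_pos.2 (by linarith)
    have htd : 4 * t + 16 ≤ d := by
      have h1 : (t : ℝ) < K ^ 4 * Real.log (2 ^ ℓ) + 1 := Nat.ceil_lt_add_one (by linarith)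
      have h2 : ((4 * t + 16 : ℕ) : ℝ) ≤ d := by
        push_cast
        nlinarith
      exact_mod_cast h2
    refine sSup_le ?_
    rintro _ ⟨E, hE, rfl⟩
    rw [EReal.coe_le_coe_iff]
    refine (E.toLin_topPoly_le G hlam hT hE ht0 htd (by rw [hcard]; exact Nat.le_ceil _)).trans ?_
    -- with `√μ ≤ 1 / 64` both terms are small compared with `1 / μ`
    have h64 : √μ ≤ 1 / 64 := by
      rw [show (1 / 64 : ℝ) = √(1 / 4096) by
        rw [show (1 / 4096 : ℝ) = (1 / 64) ^ 2 by norm_num, Real.sqrt_sq (by norm_num)]]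
      exact Real.sqrt_le_sqrt hμ'
    have hsq : √μ * √μ = μ := Real.mul_self_sqrt hμ.le
    have h1 : 1 / √μ = √μ / μ := by
      rw [div_eq_div_iff hsqrt.ne' hμ.ne', hsq, one_mul]
    rw [h1, ← sub_nonneg]
    have h2 : 1 / (32 * μ) - (√μ / μ + 12) = (1 / 32 - √μ - 12 * μ) / μ := by
      field_simp
      ring
    rw [h2]
    exact div_nonneg (by linarith) hμ.le
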